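/- **Proposition (control of the local memories in VR-FedEM).** *Model.* Let $n,m\ge 1$. Worker $i\in\{1,\dots,n\}$ holds observations $y_{i1},\dots,y_{im}$. Let $\mu$ be a measure on a measurable space $\mathsf Z$, let $\Theta\subseteq\mathbb R^d$ be open and convex, and let $p(y,z;\theta)=\rho(y,z)\exp\{\langle s(y,z),\phi(\theta)\rangle-\psi(\theta)\}$ with $s(y,z),\phi(\theta)\in\mathbb R^q$, $\rho\ge 0$, and $p(y;\theta)=\int p(y,z;\theta)\,\mu(dz)$. The functions $\mathsf R,\psi:\Theta\to\mathbb R$, $\phi$, $\rho(y_{ij},\cdot)$ and $s(y_{ij},\cdot)$ are measurable, and $0<p(y_{ij};\theta)<\infty$ for all $\theta\in\Theta$. Set $$F(\theta)=-\frac1{nm}\sum_{i,j}\log p(y_{ij};\theta)+\mathsf R(\theta),\qquad \bar s_{ij}(\theta)=\int s(y_{ij},z)\frac{p(y_{ij},z;\theta)}{p(y_{ij};\theta)}\mu(dz),\qquad \bar s_i=\frac1m\sum_{j}\bar s_{ij}.$$ Assume that 1. the integrals $\bar s_{ij}(\theta)$ converge absolutely for all $\theta\in\Theta$; 2. for every $s\in\mathbb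 R^q$, the function $\psi+\mathsf R-\langle s,\phi\rangle$ has a unique minimiser $\mathsf T(s)$ over $\Theta$; put $h_i(s)=\bar s_i(\mathsf T(s))-s$ and $h=\frac1n\sum_i h_i$; 3. $W=F\circ\mathsf T:\mathbb R^q\to\mathbb R$ is bounded below and $C^1$, its gradient is Lipschitz with constant $L_{\dot W}>0$, and $\nabla W(s)=-B(s)h(s)$ with $B(s)$ a (symmetric) positive definite matrix whose spectrum lies in $[v_{\min},v_{\max}]$, where $0<v_{\min}\le v_{\max}$ do not depend on $s$; 4. $s\mapsto\bar s_{ij}(\mathsf T(s))-s$ is Lipschitz with constant $L_{ij}$ for all $i,j$; put $L^2=\frac1{nm}\sum_{i,j}L_{ij}^2$, $L\ge0$; 5. $\mathrm{Quant}$ is a random operator on $\mathbb R^q$ and $\omega\ge 0$ is such that $\mathbb E[\mathrm{Quant}(x)]=x$ and $\mathbb E\|\mathrm{Quant}(x)\|^2\le(1+\omega)\|x\|^2$ for all $x\in\mathbb R^q$. *Algorithm (VR-FedEM).* Let $k_{\rm in},k_{\rm out}\ge1$, $\mathsf b=\lceil k_{\rm in}/(1+\omega)^2\rceil$, $\alpha=1/(1+\omega)$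 and $$\gamma=\frac{v_{\min}}{L_{\dot W}}\Big(1+4\sqrt2\,\frac{v_{\max}}{L_{\dot W}}\frac{L}{\sqrt n}(1+\omega)\Big(\omega+\frac{1+10\omega}{8}\Big)^{1/2}\Big)^{-1}.$$ Let $\hat S_{1,0}$ and $V_{1,0,i}$ be $\mathbb R^q$-valued, possibly random, initial values, and set $\hat S_{1,-1}=\hat S_{1,0}$, $V_{1,0}=\frac1n\sum_iV_{1,0,i}$, $\mathsf S_{1,0,i}=\bar s_i(\mathsf T(\hat S_{1,0}))$. For $t=1,\dots,k_{\rm out}$ and $k=0,\dots,k_{\rm in}-1$, each worker $i$ draws uniformly at random, with or without replacement, a minibatch $\mathcal B_{t,k+1,i}$ of size $\mathsf b$ in $\{1,\dots,m\}$ and $$\mathsf S_{t,k+1,i}=\mathsf S_{t,k,i}+\frac1{\mathsf b}\sum_{j\in\mathcal B_{t,k+1,i}}\big(\bar s_{ij}(\mathsf T(\hat S_{t,k}))-\bar s_{ij}(\mathsf T(\hat S_{t,k-1}))\big),\quad \Delta_{t,k+1,i}=\mathsf S_{t,k+1,i}-\hat S_{t,k}-V_{t,k,i},$$ $$V_{t,k+1,i}=V_{t,k,i}+\alpha\,\mathrm{Quant}(\Delta_{t,k+1,i}),\qquad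 H_{t,k+1}=V_{t,k}+\frac1n\sum_i\mathrm{Quant}(\Delta_{t,k+1,i}),$$ $$\hat S_{t,k+1}=\hat S_{t,k}+\gamma H_{t,k+1},\qquad V_{t,k+1}=V_{t,k}+\frac{\alpha}{n}\sum_i\mathrm{Quant}(\Delta_{t,k+1,i});$$ at the end of an outer loop, $\hat S_{t+1,0}=\hat S_{t+1,-1}=\hat S_{t,k_{\rm in}}$, $V_{t+1,0}=V_{t,k_{\rm in}}$, $V_{t+1,0,i}=V_{t,k_{\rm in},i}$ and $\mathsf S_{t+1,0,i}=\bar s_i(\mathsf T(\hat S_{t+1,0}))$. The initial values $(\hat S_{1,0},(V_{1,0,i})_i)$, all minibatches, and the noises of all uses of $\mathrm{Quant}$ are mutually independent. *Conclusion.* Let $G_{t,k}=\frac1n\sum_{i=1}^n\|V_{t,k,i}-h_i(\hat S_{t,k})\|^2$, and assume that $W(\hat S_{1,0})$ and $G_{1,0}$ are integrable. Then all $G_{t,k}$ ($1\le t\le k_{\rm out}$, $0\le k\le k_{\rm in}$) are integrable and $$\frac1{k_{\rm out}k_{\rm in}}\sum_{t=1}^{k_{\rm out}}\sum_{k=1}^{k_{\rm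 in}}\mathbb E[G_{t,k}]\le\frac{2(1+\omega)}{k_{\rm in}k_{\rm out}}\mathbb E[G_{1,0}]+16\,\frac{\gamma}{k_{\rm in}k_{\rm out}}\,\frac{(1+\omega)^2L^2}{v_{\min}}\Big(\mathbb E[W(\hat S_{1,0})]-\inf W\Big).$$ -/

import Mathlib

open MeasureTheory ProbabilityTheory

noncomputable section

namespace VRFedEM

/-- Euclidean space `ℝ^q`. -/
abbrev Vec (q : ℕ) : Type := EuclideanSpace ℝ (Fin q)

/-! ### The latent variable model -/

/-- The data of a penalised curved exponential family with latent variable `z ∈ Z`, observed by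
`n` workers holding `m` observations each:
`p(y, z; θ) = ρ(y, z) exp (⟨s(y, z), φ(θ)⟩ - ψ(θ))`, with parameter set `Θ ⊆ ℝ^d`.
The functions of `θ` are total; only their values on `Θ` are ever constrained or used. -/
structure EMModel (d q n m : ℕ) (Y Z : Type*) [MeasurableSpace Z] where
  /-- the parameter set -/
  Θ : Set (Vec d)
  /-- the penalty -/
  R : Vec d → ℝ
  φ : Vec d → Vec q
  ψ : Vec d → ℝ
  ρ : Y → Z → ℝ
  /-- the complete-data sufficient statistics -/
  s : Y → Z → Vec q
  /-- the reference measure on the latent space -/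
  μ : Measure Z
  /-- the `j`-th observation of worker `i` -/
  y : Fin n → Fin m → Y

namespace EMModel

variable {d q n m : ℕ} {Y Z : Type*} [MeasurableSpace Z] (M : EMModel d q n m Y Z)

/-- Complete-data likelihood `p(y, z; θ)`. -/
def completeLik (y : Y) (z : Z) (θ : Vec d) : ℝ :=
  M.ρ y z * Real.exp (inner ℝ (M.s y z) (M.φ θ) - M.ψ θ)

/-- Incomplete-data likelihood `p(y; θ) = ∫ p(y, z; θ) μ(dz)`. -/
def lik (y : Y) (θ : Vec d) : ℝ := ∫ z, M.completeLik y z θ ∂M.μ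

/-- Conditional density `p(z | y; θ)`. -/
def condDensity (y : Y) (θ : Vec d) (z : Z) : ℝ := M.completeLik y z θ / M.lik y θ

/-- Local loss `- m⁻¹ ∑ⱼ log p(y_ij; θ)` of worker `i`. -/
def loss (i : Fin n) (θ : Vec d) : ℝ := -((m : ℝ)⁻¹ * ∑ j, Real.log (M.lik (M.y i j) θ))

/-- Objective `F(θ) = n⁻¹ ∑ᵢ loss_i(θ) + R(θ)`. -/
def F (θ : Vec d) : ℝ := (n : ℝ)⁻¹ * ∑ i, M.loss i θ + M.R θ

/-- Conditional expectation `s̄_ij(θ) = ∫ s(y_ij, z) p(z | y_ij; θ) μ(dz)`. -/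
def sbar (i : Fin n) (j : Fin m) (θ : Vec d) : Vec q :=
  ∫ z, M.condDensity (M.y i j) θ z • M.s (M.y i j) z ∂M.μ

/-- `s̄_i = m⁻¹ ∑ⱼ s̄_ij`. -/
def sbarLocal (i : Fin n) (θ : Vec d) : Vec q := (m : ℝ)⁻¹ • ∑ j, M.sbar i j θ

/-- `θ` is a minimiser over `Θ` of `ψ + R - ⟨s, φ⟩`. -/
def IsArgmin (s : Vec q) (θ : Vec d) : Prop :=
  θ ∈ M.Θ ∧ IsMinOn (fun θ' => M.ψ θ' + M.R θ' - inner ℝ s (M.φ θ')) M.Θ θ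

/-- The M-step map `T`: the minimiser over `Θ` of `ψ + R - ⟨s, φ⟩`. -/
def T (s : Vec q) : Vec d := Classical.epsilon (M.IsArgmin s)

/-- `h_i(s) = s̄_i(T(s)) - s`. -/
def hLocal (i : Fin n) (s : Vec q) : Vec q := M.sbarLocal i (M.T s) - s

/-- The mean field `h = n⁻¹ ∑ᵢ h_i`. -/
def h (s : Vec q) : Vec q := (n : ℝ)⁻¹ • ∑ i, M.hLocal i s

/-- `W = F ∘ T`. -/
def W (s : Vec q) : ℝ := M.F (M.T s)

/-! ### Assumptions on the model -/

/-- The parameter set is convex and open, the functions of the model are measurable, and the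
log-likelihoods of the observations are finite, i.e. `0 < p(y_ij; θ) < ∞`. -/
structure IsRegular : Prop where
  convex : Convex ℝ M.Θ
  isOpen : IsOpen M.Θ
  measurable_R : Measurable (fun θ : M.Θ => M.R θ)
  measurable_φ : Measurable (fun θ : M.Θ => M.φ θ)
  measurable_ψ : Measurable (fun θ : M.Θ => M.ψ θ)
  measurable_ρ : ∀ i j, Measurable (M.ρ (M.y i j))
  nonneg_ρ : ∀ i j z, 0 ≤ M.ρ (M.y i j) z
  measurable_s : ∀ i j, Measurable (M.s (M.y i j))
  lik_finite : ∀ θ ∈ M.Θ, ∀ i j, Integrable (fun z => M.completeLik (M.y i j) z θ) M.μ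
  lik_pos : ∀ θ ∈ M.Θ, ∀ i j, 0 < M.lik (M.y i j) θ

/-- The conditional expectations `s̄_ij(θ)` (hence also the `s̄_i(θ)`) are well defined. -/
def HasCondExpectations : Prop :=
  ∀ θ ∈ M.Θ, ∀ i j,
    Integrable (fun z => M.condDensity (M.y i j) θ z • M.s (M.y i j) z) M.μ

/-- For every `s`, the minimiser of `ψ + R - ⟨s, φ⟩` over `Θ` exists and is unique. -/
def HasUniqueArgmin : Prop := ∀ s : Vec q, ∃! θ : Vec d, M.IsArgmin s θ

/-- `W` is continuously differentiable, its gradient is Lipschitz with constant `LW`, and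
`∇W(s) = - B(s) h(s)` with `B(s)` a positive definite matrix having its spectrum in
`[vmin, vmax]`, where `0 < vmin ≤ vmax`. -/
structure IsLyapunov (LW vmin vmax : ℝ) : Prop where
  contDiff : ContDiff ℝ 1 M.W
  LW_pos : 0 < LW
  lipschitz : ∀ s s' : Vec q, ‖gradient M.W s - gradient M.W s'‖ ≤ LW * ‖s - s'‖
  vmin_pos : 0 < vmin
  vmin_le_vmax : vmin ≤ vmax
  exists_B : ∃ B : Vec q → Matrix (Fin q) (Fin q) ℝ, ∀ s : Vec q,
    (B s).PosDef ∧ spectrum ℝ (B s) ⊆ Set.Icc vmin vmax ∧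
      gradient M.W s = -(WithLp.toLp 2 (Matrix.mulVec (B s) (WithLp.ofLp (M.h s))))

/-- For all `i`, `j` the map `s ↦ s̄_ij(T(s)) - s` is Lipschitz with constant `Lip i j`. -/
def IsLipschitzField (Lip : Fin n → Fin m → ℝ) : Prop :=
  ∀ i j, ∀ s s' : Vec q,
    ‖(M.sbar i j (M.T s) - s) - (M.sbar i j (M.T s') - s')‖ ≤ Lip i j * ‖s - s'‖

end EMModel

/-- `L = (n⁻¹ m⁻¹ ∑ᵢ ∑ⱼ L_ij²)^(1/2)`. -/
def meanLip {n m : ℕ} (Lip : Fin n → Fin m → ℝ) : ℝ :=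
  Real.sqrt ((n : ℝ)⁻¹ * (m : ℝ)⁻¹ * ∑ i, ∑ j, Lip i j ^ 2)

/-! ### Quantisation and minibatches -/

/-- The random operator `Quant(x) = quant x ξ`, `ξ ∼ ν`, is unbiased:
`E[Quant(x)] = x`, and `E[‖Quant(x)‖²] ≤ (1 + ω) ‖x‖²`. -/
structure IsQuantizer {q : ℕ} {U : Type*} [MeasurableSpace U] (quant : Vec q → U → Vec q)
    (ν : Measure U) (ω : ℝ) : Prop where
  measurable : Measurable (Function.uncurry quant)
  omega_nonneg : 0 ≤ ω
  memLp : ∀ x, MemLp (quant x) 2 ν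
  unbiased : ∀ x, ∫ u, quant x u ∂ν = x
  second_moment : ∀ x, ∫ u, ‖quant x u‖ ^ 2 ∂ν ≤ (1 + ω) * ‖x‖ ^ 2

/-- The two ways of sampling a minibatch. -/
inductive Sampling
  | withReplacement
  | withoutReplacement

/-- The possible outcomes of `b` successive draws among `m` examples. -/
def Sampling.outcomes (sch : Sampling) (b m : ℕ) : Set (Fin b → Fin m) :=
  match sch with
  | .withReplacement => Set.univ
  | .withoutReplacement => {J | Function.Injective J}

/-! ### The algorithm -/

/-- The variables of the algorithm at time `(t, k)`. -/
structure State (q n : ℕ) where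
  /-- `Ŝ_{t,k-1}` -/
  Sprev : Vec q
  /-- `Ŝ_{t,k}` -/
  S : Vec q
  /-- the local statistics `S_{t,k,i}` -/
  loc : Fin n → Vec q
  /-- the local memories `V_{t,k,i}` -/
  V : Fin n → Vec q
  /-- the memory `V_{t,k}` of the central server -/
  Vbar : Vec q

section Algorithm

variable {d q n m b : ℕ} {Y Z U : Type*} [MeasurableSpace Z] (M : EMModel d q n m Y Z)
  (quant : Vec q → U → Vec q) (α : ℝ)

/-- Initialisation of the algorithm at `Ŝ_{1,0} = Ŝ_{1,-1} = S₀`, `V_{1,0,i} = V₀ i`. -/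
def initState (S₀ : Vec q) (V₀ : Fin n → Vec q) : State q n where
  Sprev := S₀
  S := S₀
  loc := fun i => M.sbarLocal i (M.T S₀)
  V := V₀
  Vbar := (n : ℝ)⁻¹ • ∑ i, V₀ i

/-- Updated local statistic `S_{t,k+1,i}`, from the minibatch `J`. -/
def newLoc (st : State q n) (i : Fin n) (J : Fin b → Fin m) : Vec q :=
  st.loc i + (b : ℝ)⁻¹ • ∑ r, (M.sbar i (J r) (M.T st.S) - M.sbar i (J r) (M.T st.Sprev))

/-- `Δ_{t,k+1,i} = S_{t,k+1,i} - Ŝ_{t,k} - V_{t,k,i}`. -/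
def delta (st : State q n) (i : Fin n) (J : Fin b → Fin m) : Vec q :=
  newLoc M st i J - st.S - st.V i

/-- `H_{t,k+1} = V_{t,k} + n⁻¹ ∑ᵢ Quant(Δ_{t,k+1,i})`. -/
def fieldH (st : State q n) (J : Fin n → Fin b → Fin m) (u : Fin n → U) : Vec q :=
  st.Vbar + (n : ℝ)⁻¹ • ∑ i, quant (delta M st i (J i)) (u i)

/-- One inner iteration, with step size `γ`, minibatches `J i` and quantisation noises `u i`. -/
def step (γ : ℝ) (J : Fin n → Fin b → Fin m) (u : Fin n → U) (st : State q n) : State q n where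
  Sprev := st.S
  S := st.S + γ • fieldH M quant st J u
  loc := fun i => newLoc M st i (J i)
  V := fun i => st.V i + α • quant (delta M st i (J i)) (u i)
  Vbar := st.Vbar + (α * (n : ℝ)⁻¹) • ∑ i, quant (delta M st i (J i)) (u i)

/-- Passage from the end of an outer loop to the beginning of the next one. -/
def restart (st : State q n) : State q n where
  Sprev := st.S
  S := st.S
  loc := fun i => M.sbarLocal i (M.T st.S)
  V := st.V
  Vbar := st.Vbar

/-- The inner loop started at `st`. -/
def innerLoop (γ : ℕ → ℝ) (J : ℕ → Fin n → Fin b → Fin m) (u : ℕ → Fin n → U)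
    (st : State q n) : ℕ → State q n
  | 0 => st
  | k + 1 => step M quant α (γ k) (J k) (u k) (innerLoop γ J u st k)

/-- The state at the beginning of each outer loop. The outer loops are numbered from `0`. -/
def outerLoop (γ : ℕ → ℕ → ℝ) (kin : ℕ) (J : ℕ → ℕ → Fin n → Fin b → Fin m)
    (u : ℕ → ℕ → Fin n → U) (S₀ : Vec q) (V₀ : Fin n → Vec q) : ℕ → State q n
  | 0 => initState M S₀ V₀
  | t + 1 => restart M
      (innerLoop M quant α (γ t) (J t) (u t) (outerLoop γ kin J u S₀ V₀ t) kin)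

/-- The state of the algorithm after `k` inner iterations of the outer loop number `t + 1`.
Here `γ t k`, `J t k i` and `u t k i` stand for the step size `γ_{t+1,k+1}`, the minibatch
`B_{t+1,k+1,i}` and the noise used in `Quant(Δ_{t+1,k+1,i})`. -/
def run (γ : ℕ → ℕ → ℝ) (kin : ℕ) (J : ℕ → ℕ → Fin n → Fin b → Fin m)
    (u : ℕ → ℕ → Fin n → U) (S₀ : Vec q) (V₀ : Fin n → Vec q) (t k : ℕ) : State q n :=
  innerLoop M quant α (γ t) (J t) (u t) (outerLoop M quant α γ kin J u S₀ V₀ t) k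

/-- `G = n⁻¹ ∑ᵢ ‖V_i - h_i(Ŝ)‖²`. -/
def memoryError (st : State q n) : ℝ := (n : ℝ)⁻¹ * ∑ i, ‖st.V i - M.hLocal i st.S‖ ^ 2

end Algorithm

/-! ### The randomness of the algorithm -/

/-- The sources of randomness of a run with `kout` outer loops of length `kin`. -/
inductive Source (kout kin n : ℕ)
  | init
  | batch (t : Fin kout) (k : Fin kin) (i : Fin n)
  | noise (t : Fin kout) (k : Fin kin) (i : Fin n)

section Randomness

variable {q n m b : ℕ} {U Ω : Type*} [MeasurableSpace U] [MeasurableSpace Ω]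

/-- The σ-algebra generated by each source of randomness. -/
@[reducible]
def sourceSigma (kout kin : ℕ) (S₀ : Ω → Vec q) (V₀ : Ω → Fin n → Vec q)
    (J : ℕ → ℕ → Fin n → Ω → Fin b → Fin m) (u : ℕ → ℕ → Fin n → Ω → U) :
    Source kout kin n → MeasurableSpace Ω
  | .init => MeasurableSpace.comap (fun w => (S₀ w, V₀ w)) inferInstance
  | .batch t k i => MeasurableSpace.comap (J t k i) inferInstance
  | .noise t k i => MeasurableSpace.comap (u t k i) inferInstance

/-- The initial values (possibly random), the minibatches and the quantisation noises are
measurable and mutually independent; each minibatch is uniformly sampled, with or without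
replacement, and each noise has law `ν`. -/
structure IsRandomness (P : Measure Ω) (ν : Measure U) (sch : Sampling) (kout kin : ℕ)
    (S₀ : Ω → Vec q) (V₀ : Ω → Fin n → Vec q)
    (J : ℕ → ℕ → Fin n → Ω → Fin b → Fin m) (u : ℕ → ℕ → Fin n → Ω → U) : Prop where
  measurable_S₀ : Measurable S₀
  measurable_V₀ : Measurable V₀
  measurable_batch : ∀ t < kout, ∀ k < kin, ∀ i, Measurable (J t k i)
  measurable_noise : ∀ t < kout, ∀ k < kin, ∀ i, Measurable (u t k i)
  law_batch : ∀ t < kout, ∀ k < kin, ∀ i, P.map (J t k i) = uniformOn (sch.outcomes b m)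
  law_noise : ∀ t < kout, ∀ k < kin, ∀ i, P.map (u t k i) = ν
  indep : iIndep (sourceSigma kout kin S₀ V₀ J u) P

end Randomness

/-- The constant step size
`(vmin / LW) (1 + 4 √2 (vmax / LW) (L / √n) (1 + ω) (ω + (1 + 10 ω) / 8)^(1/2))⁻¹`. -/
def stepSize (n : ℕ) (LW vmin vmax L ω : ℝ) : ℝ :=
  vmin / LW * (1 + 4 * Real.sqrt 2 * (vmax / LW) * (L / Real.sqrt n) * (1 + ω) *
    Real.sqrt (ω + (1 + 10 * ω) / 8))⁻¹

end VRFedEM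

end

/-!
The bound comes from three coupled recursions for expectations along the run. Write
`a_i = V_{t,k,i} - h_i(Ŝ_{t,k})` for the memory errors, `e_i = S_{t,k+1,i} - s̄_i(T(Ŝ_{t,k}))` for
the errors of the recursive estimators, and `p` for `E‖Ŝ_{t,k+1} - Ŝ_{t,k}‖²`.

* *Variance reduction.* Within an outer loop the `e_i` are sums of minibatch deviations that are
  centred given the past, and they vanish at each restart. A minibatch of either kind has at most
  the variance of independent draws (`Sampling.integral_norm_sum_sq_le`), so `E n⁻¹ ∑ ‖e_i‖²` grows
  by at most `L² / b` times the previous `p`, and `E‖n⁻¹ ∑ e_i‖²`, by independence of the workers,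
  by `n` times less. Since `kin / b ≤ (1 + ω)²`, the sums over the run are at most
  `Q = (1 + ω)² L² ∑ p` and `Q / n` (`sum_error_le`).
* *Memories.* As `α² (1 + ω) = α`, quantising `e_i - a_i` contracts: `E‖a_i + α Quant(e_i - a_i)‖²`
  is at most `(1 - α) ‖a_i‖² + α ‖e_i‖²` (`integral_memory_update_le`). Young's inequality with
  parameter `α / 3` accounts for the motion of `h_i(Ŝ)` (`memoryError_step_le`). Summing, the total
  memory error is at most `(3/2) (1 + ω) E[G_{1,0}] + 6 Q` (`sum_memory_le`).
* *Descent.* The field `H_{t,k+1}` has conditional mean `h(Ŝ) + n⁻¹ ∑ e_i`. The descent lemma and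
  the polarisation of `⟨B h, h + e⟩` (`EMModel.IsLyapunov.inner_gradient_le`) show that, up to
  the variances of the estimators and of the quantisation, `W` decreases by a multiple of `‖h‖²`
  plus a multiple of `p` (`integral_W_step_le`).

The quantisation variance in the last step involves the memory errors, and `Q` involves `∑ p`, so
the sums bound each other. The step size is chosen so that this system closes:
with `X = 1 - γ LW / vmin` it says `4 (1 + 18 ω) (vmax / vmin)² Q = n X² ∑ p / γ²`
(`stepSize_spec`). For small `X` the decrease of `W` controls `∑ p` only through `∑ E‖h‖²`, for
`X` near `1` mostly directly, and the combination of both gives `∑ p / γ² ≤ (8/3) D + (7/3) Γ` for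
all `X ∈ [0, 1]` (`sum_field_le`), where `D` is `E[W(Ŝ_{1,0})] - inf W` divided by `γ vmin` and `Γ`
is a multiple of `E[G_{1,0}]`. The factor `6 · 8/3` is the constant `16` of the theorem.

Only `W(Ŝ_{1,0})` and `G_{1,0}` are assumed integrable; integrability propagates because
`‖h‖²` is at most a multiple of `W - inf W`, and because every conditional bound is integrated
through independence of the fresh randomness (`integrable_and_integral_le_of_indepFun`).
-/

noncomputable section

namespace VRFedEM

/-! ### Smooth functions and the spectrum of the preconditioner -/

/-- Descent lemma: a `C¹` function with `L`-Lipschitz gradient lies below its quadratic upper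
model. -/
theorem le_quadratic_of_lipschitz_gradient {E : Type*} [NormedAddCommGroup E]
    [InnerProductSpace ℝ E] [CompleteSpace E] {f : E → ℝ} {L : ℝ} (hf : ContDiff ℝ 1 f)
    (hL : ∀ x y, ‖gradient f x - gradient f y‖ ≤ L * ‖x - y‖) (x v : E) :
    f (x + v) ≤ f x + inner ℝ (gradient f x) v + L / 2 * ‖v‖ ^ 2 := by
  have hd : ∀ y, HasGradientAt f (gradient f y) y := fun y =>
    (hf.differentiable one_ne_zero y).hasGradientAt
  let g : ℝ → ℝ := fun t => f (x + t • v) - t * inner ℝ (gradient f x) v - L / 2 * t ^ 2 * ‖v‖ ^ 2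
  have hg : ∀ t, HasDerivAt g (inner ℝ (gradient f (x + t • v)) v - inner ℝ (gradient f x) v
      - L * t * ‖v‖ ^ 2) t := by
    intro t
    have h1 : HasDerivAt (fun t : ℝ => x + t • v) v t := by
      simpa using ((hasDerivAt_id t).smul_const v).const_add x
    have h2 := (hd (x + t • v)).hasFDerivAt.comp_hasDerivAt t h1
    have h3 : HasDerivAt (fun t : ℝ => t * inner ℝ (gradient f x) v)
        (inner ℝ (gradient f x) v) t := by
      simpa using (hasDerivAt_id t).mul_const (inner ℝ (gradient f x) v)
    have h4 : HasDerivAt (fun t : ℝ => L / 2 * t ^ 2 * ‖v‖ ^ 2) (L * t * ‖v‖ ^ 2) t := by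
      have := ((hasDerivAt_pow 2 t).const_mul (L / 2)).mul_const (‖v‖ ^ 2)
      exact this.congr_deriv (by push_cast; ring)
    have := (h2.sub h3).sub h4
    rw [InnerProductSpace.toDual_apply_apply] at this
    exact this
  have hanti : AntitoneOn g (Set.Icc 0 1) := by
    apply antitoneOn_of_deriv_nonpos (convex_Icc 0 1)
    · exact fun t _ => (hg t).continuousAt.continuousWithinAt
    · exact fun t _ => (hg t).differentiableAt.differentiableWithinAt
    · intro t ht
      rw [interior_Icc] at ht
      rw [(hg t).deriv, ← inner_sub_left]
      have h1 := real_inner_le_norm (gradient f (x + t • v) - gradient f x) v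
      have h2 := hL (x + t • v) x
      rw [add_sub_cancel_left, norm_smul, Real.norm_of_nonneg ht.1.le] at h2
      have h3 := mul_le_mul_of_nonneg_right h2 (norm_nonneg v)
      nlinarith
  have := hanti (Set.left_mem_Icc.2 zero_le_one) (Set.right_mem_Icc.2 zero_le_one) zero_le_one
  simp only [g, one_smul, zero_smul, add_zero] at this
  linarith

/-- Follows from the descent lemma applied to a gradient step of length `1 / L`. -/
theorem norm_gradient_sq_le {E : Type*} [NormedAddCommGroup E]
    [InnerProductSpace ℝ E] [CompleteSpace E] {f : E → ℝ} {L : ℝ} (hf : ContDiff ℝ 1 f)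
    (hL : ∀ x y, ‖gradient f x - gradient f y‖ ≤ L * ‖x - y‖) (hL0 : 0 < L)
    (hb : BddBelow (Set.range f)) (x : E) :
    ‖gradient f x‖ ^ 2 ≤ 2 * L * (f x - ⨅ y, f y) := by
  have h1 := le_quadratic_of_lipschitz_gradient hf hL x (-(L⁻¹ • gradient f x))
  have h2 := ciInf_le hb (x + -(L⁻¹ • gradient f x))
  rw [inner_neg_right, real_inner_smul_right, real_inner_self_eq_norm_sq, norm_neg, norm_smul,
    Real.norm_of_nonneg (inv_nonneg.2 hL0.le)] at h1
  have h3 : L / 2 * (L⁻¹ * ‖gradient f x‖) ^ 2 = L⁻¹ * ‖gradient f x‖ ^ 2 / 2 := by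
    field_simp
  rw [h3] at h1
  have h4 : L⁻¹ * ‖gradient f x‖ ^ 2 ≤ 2 * (f x - ⨅ y, f y) := by linarith
  have h5 := mul_le_mul_of_nonneg_left h4 hL0.le
  rw [mul_inv_cancel_left₀ hL0.ne'] at h5
  linarith

/-- The quadratic form of a Hermitian matrix with spectrum in `[a, b]` lies between
`a ‖x‖²` and `b ‖x‖²`. -/
theorem quadratic_form_mem_Icc {q : ℕ} {B : Matrix (Fin q) (Fin q) ℝ} (hB : B.IsHermitian)
    {a b : ℝ} (hs : spectrum ℝ B ⊆ Set.Icc a b) (x : Vec q) :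
    inner ℝ x (WithLp.toLp 2 (B.mulVec x.ofLp)) ∈ Set.Icc (a * ‖x‖ ^ 2) (b * ‖x‖ ^ 2) := by
  have key : ∀ c : ℝ, (algebraMap ℝ (Matrix (Fin q) (Fin q) ℝ) c).IsHermitian := fun c => by
    rw [Matrix.algebraMap_eq_diagonal]
    exact Matrix.isHermitian_diagonal _
  have hx : x.ofLp ⬝ᵥ x.ofLp = ‖x‖ ^ 2 := by
    rw [EuclideanSpace.real_norm_sq_eq]
    simp [dotProduct, sq]
  have hin : inner ℝ x (WithLp.toLp 2 (B.mulVec x.ofLp)) = x.ofLp ⬝ᵥ B.mulVec x.ofLp := by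
    rw [PiLp.inner_apply]
    simp [dotProduct, mul_comm]
  have halg : ∀ c : ℝ, (algebraMap ℝ (Matrix (Fin q) (Fin q) ℝ) c).mulVec x.ofLp
      = c • x.ofLp := fun c => by
    rw [Algebra.algebraMap_eq_smul_one, Matrix.smul_mulVec, Matrix.one_mulVec]
  rw [hin, Set.mem_Icc]
  constructor
  · have : (B - algebraMap ℝ _ a).PosSemidef := by
      rw [Matrix.posSemidef_iff_isHermitian_and_spectrum_nonneg]
      refine ⟨hB.sub (key a), fun z hz => ?_⟩
      rw [← spectrum.sub_singleton_eq] at hz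
      obtain ⟨y, hy, w, rfl, rfl⟩ := hz
      exact sub_nonneg.2 (hs hy).1
    have h := this.dotProduct_mulVec_nonneg x.ofLp
    rw [star_trivial, Matrix.sub_mulVec, dotProduct_sub, halg, dotProduct_smul, hx,
      smul_eq_mul] at h
    linarith
  · have : (algebraMap ℝ _ b - B).PosSemidef := by
      rw [Matrix.posSemidef_iff_isHermitian_and_spectrum_nonneg]
      refine ⟨(key b).sub hB, fun z hz => ?_⟩
      rw [← spectrum.singleton_sub_eq] at hz
      obtain ⟨y, rfl, w, hw, rfl⟩ := hz
      exact sub_nonneg.2 (hs hw).2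
    have h := this.dotProduct_mulVec_nonneg x.ofLp
    rw [star_trivial, Matrix.sub_mulVec, dotProduct_sub, halg, dotProduct_smul, hx,
      smul_eq_mul] at h
    linarith

namespace EMModel

variable {d q n m : ℕ} {Y Z : Type*} [MeasurableSpace Z] {M : EMModel d q n m Y Z}
  {LW vmin vmax : ℝ}

/-- Polarisation of the preconditioned inner product `⟨∇W(s), h(s) + e⟩`: moving along the mean
field perturbed by `e` decreases `W` up to a term in `‖e‖²`. -/
theorem IsLyapunov.inner_gradient_le (hLyap : M.IsLyapunov LW vmin vmax) (s e : Vec q) :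
    inner ℝ (gradient M.W s) (M.h s + e) ≤
      -(vmin / 2) * ‖M.h s‖ ^ 2 - vmin / 2 * ‖M.h s + e‖ ^ 2 + vmax / 2 * ‖e‖ ^ 2 := by
  obtain ⟨B, hB⟩ := hLyap.exists_B
  obtain ⟨hpos, hspec, hgrad⟩ := hB s
  have hsymm : ∀ x y : Vec q, inner ℝ (WithLp.toLp 2 ((B s).mulVec x.ofLp)) y
      = inner ℝ x (WithLp.toLp 2 ((B s).mulVec y.ofLp)) := by
    intro x y
    have h1 : (B s).transpose = B s := by
      simpa [Matrix.conjTranspose_eq_transpose_of_trivial] using hpos.isHermitian.eq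
    have : (y.ofLp ⬝ᵥ (B s).mulVec x.ofLp) = (B s).mulVec y.ofLp ⬝ᵥ x.ofLp := by
      rw [Matrix.dotProduct_mulVec, ← Matrix.mulVec_transpose, h1]
    simpa [PiLp.inner_apply, dotProduct, mul_comm] using this
  have hQ := fun x => quadratic_form_mem_Icc hpos.isHermitian hspec x
  have h1 := (hQ (M.h s)).1
  have h2 := (hQ (M.h s + e)).1
  have h3 := (hQ e).2
  have hadd : ∀ x y : Vec q, WithLp.toLp 2 ((B s).mulVec (x + y).ofLp)
      = WithLp.toLp 2 ((B s).mulVec x.ofLp) + WithLp.toLp 2 ((B s).mulVec y.ofLp) := by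
    intro x y
    rw [WithLp.ofLp_add, Matrix.mulVec_add, WithLp.toLp_add]
  rw [hadd, inner_add_left, inner_add_right, inner_add_right] at h2
  rw [hgrad, inner_neg_left, hsymm, hadd, inner_add_right]
  have h4 := hsymm e (M.h s)
  rw [real_inner_comm] at h4
  linarith

theorem IsLyapunov.norm_h_le (hLyap : M.IsLyapunov LW vmin vmax) (s : Vec q) :
    vmin * ‖M.h s‖ ≤ ‖gradient M.W s‖ := by
  have h1 := hLyap.inner_gradient_le s 0
  simp only [add_zero, norm_zero] at h1
  have h2 := neg_le_of_abs_le (abs_real_inner_le_norm (gradient M.W s) (M.h s))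
  rcases (norm_nonneg (M.h s)).eq_or_lt with h0 | h0
  · rw [← h0]
    simp
  · nlinarith

/-- The squared mean field is bounded by a multiple of the excess of `W` over its infimum. -/
theorem IsLyapunov.norm_h_sq_le (hLyap : M.IsLyapunov LW vmin vmax)
    (hBdd : BddBelow (Set.range M.W)) (s : Vec q) :
    ‖M.h s‖ ^ 2 ≤ 2 * LW / vmin ^ 2 * (M.W s - ⨅ s', M.W s') := by
  have h1 := norm_gradient_sq_le hLyap.contDiff hLyap.lipschitz hLyap.LW_pos hBdd s
  have h2 := pow_le_pow_left₀ (mul_nonneg hLyap.vmin_pos.le (norm_nonneg _)) (hLyap.norm_h_le s) 2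
  rw [div_mul_eq_mul_div, le_div_iff₀ (pow_pos hLyap.vmin_pos 2)]
  nlinarith

variable {Lip : Fin n → Fin m → ℝ}

theorem IsLipschitzField.continuous_sbar (hLip : M.IsLipschitzField Lip) (i : Fin n)
    (j : Fin m) : Continuous fun s => M.sbar i j (M.T s) := by
  have h : LipschitzWith (Real.toNNReal |Lip i j|) fun s => M.sbar i j (M.T s) - s := by
    refine LipschitzWith.of_dist_le_mul fun s s' => ?_
    rw [dist_eq_norm, dist_eq_norm, Real.coe_toNNReal _ (abs_nonneg _)]
    exact (hLip i j s s').trans (mul_le_mul_of_nonneg_right (le_abs_self _) (norm_nonneg _))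
  have := h.continuous.add continuous_id
  exact this.congr fun s => sub_add_cancel _ _

theorem IsLipschitzField.continuous_sbarLocal (hLip : M.IsLipschitzField Lip) (i : Fin n) :
    Continuous fun s => M.sbarLocal i (M.T s) :=
  (continuous_finsetSum Finset.univ fun j _ => hLip.continuous_sbar i j).const_smul (m : ℝ)⁻¹

theorem IsLipschitzField.continuous_hLocal (hLip : M.IsLipschitzField Lip) (i : Fin n) :
    Continuous (M.hLocal i) :=
  (hLip.continuous_sbarLocal i).sub continuous_id

theorem IsLipschitzField.continuous_h (hLip : M.IsLipschitzField Lip) : Continuous M.h :=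
  (continuous_finsetSum Finset.univ fun i _ => hLip.continuous_hLocal i).const_smul (n : ℝ)⁻¹

theorem IsLipschitzField.sq_norm_sub_le (hLip : M.IsLipschitzField Lip) (i : Fin n) (j : Fin m)
    (s s' : Vec q) :
    ‖(M.sbar i j (M.T s) - s) - (M.sbar i j (M.T s') - s')‖ ^ 2 ≤ Lip i j ^ 2 * ‖s - s'‖ ^ 2 := by
  rw [← mul_pow]
  exact pow_le_pow_left₀ (norm_nonneg _) (hLip i j s s') 2

end EMModel

/-! ### Second moments of sums of independent vectors -/

section Moments

variable {Ω E : Type*} [MeasurableSpace Ω] [NormedAddCommGroup E] [InnerProductSpace ℝ E]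

theorem integrable_inner_of_memLp_two {P : Measure Ω} {X Y : Ω → E} (hX : MemLp X 2 P)
    (hY : MemLp Y 2 P) : Integrable (fun w => inner ℝ (X w) (Y w)) P := by
  refine ((hX.norm.integrable_mul hY.norm)).mono' (hX.1.inner hY.1) (ae_of_all _ fun w => ?_)
  exact norm_inner_le_norm _ _

variable [CompleteSpace E]

theorem integral_norm_const_add_sq {P : Measure Ω} [IsProbabilityMeasure P] {X : Ω → E}
    (hX : MemLp X 2 P) (c : E) :
    ∫ w, ‖c + X w‖ ^ 2 ∂P = ‖c‖ ^ 2 + 2 * inner ℝ c (∫ w, X w ∂P) + ∫ w, ‖X w‖ ^ 2 ∂P := by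
  have h1 : Integrable X P := hX.integrable one_le_two
  have h2 : Integrable (fun w => ‖X w‖ ^ 2) P := hX.integrable_norm_pow two_ne_zero
  have h3 : Integrable (fun w => inner ℝ c (X w)) P := h1.const_inner c
  simp_rw [norm_add_sq_real]
  have h4 : Integrable (fun w => ‖c‖ ^ 2 + 2 * inner ℝ c (X w)) P :=
    (integrable_const _).add (h3.const_mul 2)
  rw [integral_add h4 h2, integral_add (integrable_const _) (h3.const_mul 2), integral_const_mul,
    integral_inner h1]
  simp

theorem integral_comp_eval_pi {ι : Type*} [Fintype ι] {A : ι → Type*}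
    [∀ i, MeasurableSpace (A i)] {μ : ∀ i, Measure (A i)} [∀ i, IsProbabilityMeasure (μ i)]
    {F : Type*} [NormedAddCommGroup F] [NormedSpace ℝ F] (i : ι) {g : A i → F}
    (hg : AEStronglyMeasurable g (μ i)) :
    ∫ w, g (w i) ∂(Measure.pi μ) = ∫ a, g a ∂μ i := by
  have hmp := measurePreserving_eval μ i
  have hg' : AEStronglyMeasurable g ((Measure.pi μ).map (Function.eval i)) := by
    rwa [hmp.map_eq]
  rw [← hmp.map_eq, integral_map hmp.measurable.aemeasurable hg']

theorem integral_pi_norm_const_add_sq {ι : Type*} [Fintype ι] {A : ι → Type*}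
    [∀ i, MeasurableSpace (A i)] {μ : ∀ i, Measure (A i)} [∀ i, IsProbabilityMeasure (μ i)]
    (i : ι) {X : A i → E} (hX : MemLp X 2 (μ i)) (c : E) :
    ∫ w, ‖c + X (w i)‖ ^ 2 ∂(Measure.pi μ) =
      ‖c‖ ^ 2 + 2 * inner ℝ c (∫ a, X a ∂μ i) + ∫ a, ‖X a‖ ^ 2 ∂μ i := by
  rw [← integral_norm_const_add_sq hX]
  exact integral_comp_eval_pi i (g := fun a => ‖c + X a‖ ^ 2) ((hX.1.const_add c).norm.pow 2)

variable [MeasurableSpace E] [BorelSpace E]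

/-- Pythagoras for centred, pairwise independent random vectors. -/
theorem integral_norm_const_add_sum_sq {P : Measure Ω} [IsProbabilityMeasure P] {ι : Type*}
    [Fintype ι] {X : ι → Ω → E} (hX : ∀ i, MemLp (X i) 2 P) (h0 : ∀ i, ∫ w, X i w ∂P = 0)
    (hI : ∀ i j, i ≠ j → IndepFun (X i) (X j) P) (c : E) :
    ∫ w, ‖c + ∑ i, X i w‖ ^ 2 ∂P = ‖c‖ ^ 2 + ∑ i, ∫ w, ‖X i w‖ ^ 2 ∂P := by
  classical
  have hS : MemLp (fun w => ∑ i, X i w) 2 P := memLp_finsetSum _ fun i _ => hX i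
  rw [integral_norm_const_add_sq hS, integral_finsetSum _ fun i _ => (hX i).integrable one_le_two]
  have h2 : ∀ w, ‖∑ i, X i w‖ ^ 2 = ∑ i, ∑ j, inner ℝ (X i w) (X j w) := by
    intro w
    rw [← real_inner_self_eq_norm_sq, sum_inner]
    simp_rw [inner_sum]
  simp_rw [h2, h0, Finset.sum_const_zero, inner_zero_right, mul_zero, add_zero]
  rw [integral_finsetSum _ fun i _ => integrable_finsetSum _ fun j _ =>
    integrable_inner_of_memLp_two (hX i) (hX j)]
  congr 1
  refine Finset.sum_congr rfl fun i _ => ?_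
  rw [integral_finsetSum _ fun j _ => integrable_inner_of_memLp_two (hX i) (hX j),
    Finset.sum_eq_single i]
  · simp_rw [real_inner_self_eq_norm_sq]
  · intro j _ hj
    have := (hI i j hj.symm).integral_bilin ((hX i).integrable one_le_two)
      ((hX j).integrable one_le_two) (innerSL ℝ)
    rw [h0 i, map_zero] at this
    exact this
  · simp

/-- Bias-variance decomposition of a sum of independent vectors on a product space. -/
theorem integral_pi_norm_const_add_sum_sq {ι : Type*} [Fintype ι] {A : ι → Type*}
    [∀ i, MeasurableSpace (A i)] {μ : ∀ i, Measure (A i)} [∀ i, IsProbabilityMeasure (μ i)]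
    {X : ∀ i, A i → E} (hX : ∀ i, MemLp (X i) 2 (μ i)) (c : E) :
    ∫ w, ‖c + ∑ i, X i (w i)‖ ^ 2 ∂(Measure.pi μ) =
      ‖c + ∑ i, ∫ a, X i a ∂μ i‖ ^ 2
        + ∑ i, (∫ a, ‖X i a‖ ^ 2 ∂μ i - ‖∫ a, X i a ∂μ i‖ ^ 2) := by
  classical
  let Y : ∀ i, A i → E := fun i a => X i a - ∫ a, X i a ∂μ i
  have hY : ∀ i, MemLp (Y i) 2 (μ i) := fun i => (hX i).sub (memLp_const _)
  have hmp := fun i => measurePreserving_eval μ i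
  have h1 : ∀ w : ∀ i, A i, c + ∑ i, X i (w i)
      = (c + ∑ i, ∫ a, X i a ∂μ i) + ∑ i, Y i (w i) := by
    intro w
    simp only [Y, Finset.sum_sub_distrib]
    abel
  have hY0 : ∀ i, ∫ a, Y i a ∂μ i = 0 := fun i => by
    simp only [Y]
    rw [integral_sub ((hX i).integrable one_le_two) (integrable_const _)]
    simp
  simp_rw [h1]
  rw [integral_norm_const_add_sum_sq (P := Measure.pi μ) (X := fun i w => Y i (w i))
    (fun i => (hY i).comp_measurePreserving (hmp i))
    (fun i => by rw [integral_comp_eval_pi i (hY i).1, hY0 i])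
    (fun i j hij => (iIndepFun_pi (X := Y) fun i => (hY i).1.aemeasurable).indepFun hij)]
  congr 1
  refine Finset.sum_congr rfl fun i _ => ?_
  rw [integral_comp_eval_pi i (g := fun a => ‖Y i a‖ ^ 2) ((hY i).1.norm.pow 2)]
  have := integral_norm_const_add_sq (hX i) (-(∫ a, X i a ∂μ i))
  rw [norm_neg, inner_neg_left, real_inner_self_eq_norm_sq] at this
  simp only [Y, sub_eq_neg_add]
  rw [this]
  ring

end Moments

/-! ### Fresh randomness -/

/-- Averaging over fresh randomness: if `Y` has law `κ` and is independent of `X`, a bound on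
`∫ f(x, y) κ(dy)` for each value `x` of `X` may be integrated over the law of `X`. -/
theorem integrable_and_integral_le_of_indepFun {Ω E F : Type*} [MeasurableSpace Ω]
    [MeasurableSpace E] [MeasurableSpace F] {P : Measure Ω} [IsProbabilityMeasure P]
    {X : Ω → E} {Y : Ω → F} (hX : Measurable X) (hY : Measurable Y) (hXY : IndepFun X Y P)
    {κ : Measure F} (hκ : P.map Y = κ) {f : E × F → ℝ} (hf : Measurable f)
    (hf0 : ∀ z, 0 ≤ f z) {φ : E → ℝ} (hφ : Integrable (fun w => φ (X w)) P)
    (hint : ∀ w, Integrable (fun y => f (X w, y)) κ)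
    (hle : ∀ w, ∫ y, f (X w, y) ∂κ ≤ φ (X w)) :
    Integrable (fun w => f (X w, Y w)) P ∧ ∫ w, f (X w, Y w) ∂P ≤ ∫ w, φ (X w) ∂P := by
  have hprob : IsProbabilityMeasure κ := hκ ▸ Measure.isProbabilityMeasure_map hY.aemeasurable
  have hmap : P.map (fun w => (X w, Y w)) = (P.map X).prod κ := by
    rw [← hκ]
    exact (indepFun_iff_map_prod_eq_prod_map_map hX.aemeasurable hY.aemeasurable).1 hXY
  have hXYm : Measurable fun w => (X w, Y w) := hX.prodMk hY
  have hI : Measurable fun x => ∫ y, f (x, y) ∂κ :=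
    (hf.stronglyMeasurable.integral_prod_right').measurable
  have hIint : Integrable (fun w => ∫ y, f (X w, y) ∂κ) P := by
    refine hφ.mono' (hI.comp hX).aestronglyMeasurable (ae_of_all _ fun w => ?_)
    rw [Real.norm_of_nonneg (integral_nonneg fun y => hf0 _)]
    exact hle w
  have hprod : Integrable f ((P.map X).prod κ) := by
    rw [integrable_prod_iff hf.aestronglyMeasurable]
    constructor
    · have hs : MeasurableSet {x | Integrable (fun y => f (x, y)) κ} :=
        measurableSet_integrable (f := fun x y => f (x, y)) hf.stronglyMeasurable
      exact (ae_map_iff hX.aemeasurable hs).2 (ae_of_all _ hint)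
    · rw [integrable_map_measure
        (hf.stronglyMeasurable.norm.integral_prod_right').aestronglyMeasurable hX.aemeasurable]
      refine hIint.congr (ae_of_all _ fun w => ?_)
      exact integral_congr_ae (ae_of_all _ fun y => (Real.norm_of_nonneg (hf0 _)).symm)
  constructor
  · have := hprod
    rw [← hmap, integrable_map_measure hf.aestronglyMeasurable hXYm.aemeasurable] at this
    exact this
  · calc ∫ w, f (X w, Y w) ∂P = ∫ z, f z ∂((P.map X).prod κ) := by
          rw [← hmap, integral_map hXYm.aemeasurable hf.aestronglyMeasurable]
      _ = ∫ w, ∫ y, f (X w, y) ∂κ ∂P := by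
          rw [integral_prod _ hprod, integral_map hX.aemeasurable hI.aestronglyMeasurable]
      _ ≤ ∫ w, φ (X w) ∂P := integral_mono hIint hφ hle

/-! ### Minibatches -/

theorem Sampling.exists_integral_uniformOn (sch : Sampling) (b m : ℕ)
    (hprob : IsProbabilityMeasure (uniformOn (sch.outcomes b m))) :
    ∃ O : Finset (Fin b → Fin m), (∀ J, J ∈ O ↔ J ∈ sch.outcomes b m) ∧ 0 < O.card ∧
      ∀ {E : Type} [NormedAddCommGroup E] [NormedSpace ℝ E]
        [CompleteSpace E] (f : (Fin b → Fin m) → E),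
        ∫ J, f J ∂(uniformOn (sch.outcomes b m)) = (O.card : ℝ)⁻¹ • ∑ J ∈ O, f J := by
  classical
  let O : Finset (Fin b → Fin m) := Finset.univ.filter (· ∈ sch.outcomes b m)
  have hO : (O : Set (Fin b → Fin m)) = sch.outcomes b m := by
    ext
    simp [O]
  have hreal : ∀ J, (uniformOn (sch.outcomes b m)).real {J}
      = if J ∈ O then (O.card : ℝ)⁻¹ else 0 := by
    intro J
    rw [← hO, ← Finset.coe_singleton, Measure.real, uniformOn_apply_finset]
    by_cases h : J ∈ O
    · rw [Finset.inter_singleton_of_mem h]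
      simp [h]
    · rw [Finset.inter_singleton_of_notMem h]
      simp [h]
  refine ⟨O, fun J => by simp [O], ?_, fun f => ?_⟩
  · rw [Finset.card_pos, Finset.nonempty_iff_ne_empty]
    rintro h
    have := hprob.measure_univ
    rw [← hO, h, Finset.coe_empty, uniformOn_empty_meas] at this
    simp at this
  · rw [integral_fintype .of_finite]
    simp_rw [hreal, ite_smul, zero_smul]
    rw [← Finset.sum_filter, Finset.smul_sum]
    simp

/-- Both sampling schemes are invariant under relabelling the examples. -/
theorem Sampling.sum_comp_perm {sch : Sampling} {b m : ℕ} {O : Finset (Fin b → Fin m)}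
    (hO : ∀ J, J ∈ O ↔ J ∈ sch.outcomes b m) {F : Type*} [AddCommMonoid F]
    (f : (Fin b → Fin m) → F) (σ : Equiv.Perm (Fin m)) :
    ∑ J ∈ O, f (fun r => σ (J r)) = ∑ J ∈ O, f J := by
  refine Finset.sum_equiv (Equiv.arrowCongr (Equiv.refl (Fin b)) σ) (fun J => ?_) fun J _ => rfl
  rw [hO, hO]
  cases sch with
  | withReplacement => simp [Sampling.outcomes]
  | withoutReplacement =>
    simp only [Sampling.outcomes, Set.mem_ofPred_eq]
    exact (σ.injective.of_comp_iff J).symm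

/-- Each draw is uniform. -/
theorem Sampling.smul_sum_apply {sch : Sampling} {b m : ℕ} {O : Finset (Fin b → Fin m)}
    (hO : ∀ J, J ∈ O ↔ J ∈ sch.outcomes b m) {F : Type*} [AddCommMonoid F]
    (f : Fin m → F) (r : Fin b) :
    m • ∑ J ∈ O, f (J r) = O.card • ∑ j, f j := by
  rcases Nat.eq_zero_or_pos m with rfl | hm
  · simp
  have : NeZero m := ⟨hm.ne'⟩
  calc m • ∑ J ∈ O, f (J r) = ∑ z : Fin m, ∑ J ∈ O, f (J r + z) := by
        have h : ∀ z : Fin m, ∑ J ∈ O, f (J r + z) = ∑ J ∈ O, f (J r) := fun z =>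
          Sampling.sum_comp_perm hO (fun J => f (J r)) (Equiv.addRight z)
        simp [h]
    _ = ∑ J ∈ O, ∑ j, f j := by
        rw [Finset.sum_comm]
        exact Finset.sum_congr rfl fun J _ => Equiv.sum_comp (Equiv.addLeft (J r)) f
    _ = O.card • ∑ j, f j := by simp

/-- Two distinct draws are uncorrelated or negatively correlated. -/
theorem Sampling.sum_inner_nonpos {sch : Sampling} {b m : ℕ} {O : Finset (Fin b → Fin m)}
    (hO : ∀ J, J ∈ O ↔ J ∈ sch.outcomes b m) {E : Type*} [NormedAddCommGroup E]
    [InnerProductSpace ℝ E] {c : Fin m → E} (hc : ∑ j, c j = 0) {r r' : Fin b} (hr : r ≠ r') :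
    ∑ J ∈ O, inner ℝ (c (J r)) (c (J r')) ≤ 0 := by
  classical
  cases sch with
  | withReplacement =>
    have : O = Finset.univ := by
      ext J
      simp [hO, Sampling.outcomes]
    rw [this, ← Equiv.sum_comp (Equiv.funSplitAt r (Fin m)).symm, Fintype.sum_prod_type_right]
    refine (Finset.sum_eq_zero fun J' _ => ?_).le
    simp only [Equiv.funSplitAt_symm_apply, dif_pos, dif_neg hr.symm]
    rw [← sum_inner, hc, inner_zero_left]
  | withoutReplacement =>
    -- `R a a'` is the sum over all relabellings; it does not depend on the pair `a ≠ a'`.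
    let R : Fin m → Fin m → ℝ := fun a a' =>
      ∑ σ : Equiv.Perm (Fin m), inner ℝ (c (σ a)) (c (σ a'))
    have hR : ∀ a a', a ≠ a' → R a a' ≤ 0 := by
      intro a a' haa'
      have hsymm : ∀ x ∈ Finset.univ.erase a, R a x = R a a' := by
        intro x hx
        have hxa : x ≠ a := Finset.ne_of_mem_erase hx
        refine Eq.trans (Finset.sum_congr rfl fun σ _ => ?_)
          (Equiv.sum_comp (Equiv.mulRight (Equiv.swap x a'))
            (fun σ : Equiv.Perm (Fin m) => (inner ℝ (c (σ a)) (c (σ a')) : ℝ)))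
        simp [Equiv.swap_apply_of_ne_of_ne hxa.symm haa']
      have hsum : ∑ x, R a x = 0 := by
        rw [Finset.sum_comm]
        refine Finset.sum_eq_zero fun σ _ => ?_
        rw [← inner_sum, Equiv.sum_comp σ c, hc, inner_zero_right]
      rw [← Finset.add_sum_erase _ _ (Finset.mem_univ a), Finset.sum_congr rfl hsymm,
        Finset.sum_const, nsmul_eq_mul] at hsum
      have hpos : 0 ≤ R a a := Finset.sum_nonneg fun σ _ => real_inner_self_nonneg
      have hcard : (0 : ℝ) < (Finset.univ.erase a).card :=
        Nat.cast_pos.2 (Finset.card_pos.2 ⟨a', Finset.mem_erase.2 ⟨haa'.symm, Finset.mem_univ _⟩⟩)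
      nlinarith
    have h1 : (Fintype.card (Equiv.Perm (Fin m)) : ℝ) * ∑ J ∈ O, inner ℝ (c (J r)) (c (J r'))
        = ∑ J ∈ O, R (J r) (J r') := by
      rw [Finset.sum_comm, Finset.sum_congr rfl fun σ _ =>
        Sampling.sum_comp_perm hO (fun J => (inner ℝ (c (J r)) (c (J r')) : ℝ)) σ]
      simp
    have h2 : ∑ J ∈ O, R (J r) (J r') ≤ 0 :=
      Finset.sum_nonpos fun J hJ => hR _ _ fun h => hr (((hO J).1 hJ) h)
    have h3 : (0 : ℝ) < Fintype.card (Equiv.Perm (Fin m)) := Nat.cast_pos.2 Fintype.card_pos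
    rw [← h1] at h2
    exact nonpos_of_mul_nonpos_right h2 h3

/-- A minibatch mean of a centred family is unbiased. -/
theorem Sampling.integral_sum_eq_zero {sch : Sampling} {b m : ℕ} (hm : 0 < m)
    (hprob : IsProbabilityMeasure (uniformOn (sch.outcomes b m))) {E : Type}
    [NormedAddCommGroup E] [NormedSpace ℝ E] [CompleteSpace E] {c : Fin m → E}
    (hc : ∑ j, c j = 0) : ∫ J, ∑ r, c (J r) ∂(uniformOn (sch.outcomes b m)) = 0 := by
  obtain ⟨O, hO, -, hint⟩ := sch.exists_integral_uniformOn b m hprob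
  rw [hint, Finset.sum_comm]
  refine (congrArg _ (Finset.sum_eq_zero fun r _ => ?_)).trans (smul_zero _)
  have := Sampling.smul_sum_apply hO c r
  rw [hc, smul_zero, ← Nat.cast_smul_eq_nsmul ℝ] at this
  exact (smul_eq_zero.1 this).resolve_left (Nat.cast_ne_zero.2 hm.ne')

/-- The variance of a minibatch sum is at most that of independent uniform draws. -/
theorem Sampling.integral_norm_sum_sq_le {sch : Sampling} {b m : ℕ} (hm : 0 < m)
    (hprob : IsProbabilityMeasure (uniformOn (sch.outcomes b m))) {E : Type}
    [NormedAddCommGroup E] [InnerProductSpace ℝ E] {c : Fin m → E}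
    (hc : ∑ j, c j = 0) :
    ∫ J, ‖∑ r, c (J r)‖ ^ 2 ∂(uniformOn (sch.outcomes b m)) ≤
      b * ((m : ℝ)⁻¹ * ∑ j, ‖c j‖ ^ 2) := by
  obtain ⟨O, hO, hcard, hint⟩ := sch.exists_integral_uniformOn b m hprob
  have hO0 : (0 : ℝ) < O.card := Nat.cast_pos.2 hcard
  have hm0 : (0 : ℝ) < m := Nat.cast_pos.2 hm
  have hexp : ∀ J : Fin b → Fin m, ‖∑ r, c (J r)‖ ^ 2
      = ∑ r, ∑ r', inner ℝ (c (J r)) (c (J r')) := by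
    intro J
    rw [← real_inner_self_eq_norm_sq, sum_inner]
    simp_rw [inner_sum]
  have hrow : ∀ r : Fin b, ∑ J ∈ O, ∑ r', inner ℝ (c (J r)) (c (J r'))
      ≤ O.card * ((m : ℝ)⁻¹ * ∑ j, ‖c j‖ ^ 2) := by
    intro r
    rw [Finset.sum_comm, ← Finset.add_sum_erase _ _ (Finset.mem_univ r)]
    have h1 : ∑ r' ∈ Finset.univ.erase r, ∑ J ∈ O, (inner ℝ (c (J r)) (c (J r')) : ℝ) ≤ 0 :=
      Finset.sum_nonpos fun r' hr' =>
        Sampling.sum_inner_nonpos hO hc (Finset.ne_of_mem_erase hr').symm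
    have h2 := Sampling.smul_sum_apply hO (fun j => ‖c j‖ ^ 2) r
    rw [nsmul_eq_mul, nsmul_eq_mul] at h2
    simp_rw [real_inner_self_eq_norm_sq]
    have h3 : ∑ J ∈ O, ‖c (J r)‖ ^ 2 = O.card * ((m : ℝ)⁻¹ * ∑ j, ‖c j‖ ^ 2) := by
      field_simp
      linarith
    linarith
  rw [hint, smul_eq_mul, inv_mul_le_iff₀ hO0]
  simp_rw [hexp]
  rw [Finset.sum_comm]
  refine (Finset.sum_le_sum fun r _ => hrow r).trans (le_of_eq ?_)
  simp
  ring

/-! ### One iteration from a fixed state -/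

section OneStep

variable {d q n m b : ℕ} {Y Z U : Type*} [MeasurableSpace Z] (M : EMModel d q n m Y Z)

/-- `n⁻¹ ∑ᵢ ‖S_{t,k,i} - s̄_i(T(Ŝ_{t,k-1}))‖²`, the mean squared error of the local statistics. -/
def meanSqErr (st : State q n) : ℝ :=
  (n : ℝ)⁻¹ * ∑ i, ‖st.loc i - M.sbarLocal i (M.T st.Sprev)‖ ^ 2

/-- `‖n⁻¹ ∑ᵢ (S_{t,k,i} - s̄_i(T(Ŝ_{t,k-1})))‖²`, the squared error of the averaged statistics. -/
def sqMeanErr (st : State q n) : ℝ :=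
  ‖(n : ℝ)⁻¹ • ∑ i, (st.loc i - M.sbarLocal i (M.T st.Sprev))‖ ^ 2

/-- `‖Ŝ_{t,k} - Ŝ_{t,k-1}‖²`. -/
def sqIncr (st : State q n) : ℝ := ‖st.S - st.Sprev‖ ^ 2

/-- The error `S_{t,k+1,i} - s̄_i(T(Ŝ_{t,k}))` of the updated local statistic. -/
def newErr (st : State q n) (i : Fin n) (J : Fin b → Fin m) : Vec q :=
  newLoc M st i J - M.sbarLocal i (M.T st.S)

/-- The mean squared error of the local statistics updated with the minibatches `J`. -/
def newMeanSqErr (st : State q n) (J : Fin n → Fin b → Fin m) : ℝ :=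
  (n : ℝ)⁻¹ * ∑ i, ‖newErr M st i (J i)‖ ^ 2

/-- The squared error of the average of the local statistics updated with the minibatches `J`. -/
def newSqMeanErr (st : State q n) (J : Fin n → Fin b → Fin m) : ℝ :=
  ‖(n : ℝ)⁻¹ • ∑ i, newErr M st i (J i)‖ ^ 2

variable {M}

theorem sum_norm_sub_mean_sq_le {E : Type*} [NormedAddCommGroup E] [InnerProductSpace ℝ E]
    (Y : Fin m → E) : ∑ j, ‖Y j - (m : ℝ)⁻¹ • ∑ j', Y j'‖ ^ 2 ≤ ∑ j, ‖Y j‖ ^ 2 := by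
  rcases Nat.eq_zero_or_pos m with rfl | hm
  · simp
  have hm0 : (0 : ℝ) < m := Nat.cast_pos.2 hm
  set S := ∑ j', Y j' with hS
  simp_rw [norm_sub_sq_real]
  rw [Finset.sum_add_distrib, Finset.sum_sub_distrib, ← Finset.mul_sum, ← sum_inner, ← hS,
    real_inner_smul_right, real_inner_self_eq_norm_sq, norm_smul,
    Real.norm_of_nonneg (inv_nonneg.2 hm0.le)]
  simp only [Finset.sum_const, Finset.card_univ, Fintype.card_fin, nsmul_eq_mul]
  have : (m : ℝ) * ((m : ℝ)⁻¹ * ‖S‖) ^ 2 = (m : ℝ)⁻¹ * ‖S‖ ^ 2 := by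
    field_simp
  rw [this]
  have : 0 ≤ (m : ℝ)⁻¹ * ‖S‖ ^ 2 := by positivity
  linarith

/-- The deviation of the increment of `s̄_ij ∘ T` from its mean over `j`. -/
def incrDev (M : EMModel d q n m Y Z) (st : State q n) (i : Fin n) (j : Fin m) : Vec q :=
  (M.sbar i j (M.T st.S) - M.sbar i j (M.T st.Sprev))
    - (M.sbarLocal i (M.T st.S) - M.sbarLocal i (M.T st.Sprev))

theorem sum_incrDev (hm : 0 < m) (st : State q n) (i : Fin n) : ∑ j, incrDev M st i j = 0 := by
  have hm0 : (m : ℝ) ≠ 0 := Nat.cast_ne_zero.2 hm.ne'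
  simp only [incrDev, EMModel.sbarLocal, Finset.sum_sub_distrib, Finset.sum_const,
    Finset.card_univ, Fintype.card_fin, ← Nat.cast_smul_eq_nsmul ℝ, smul_inv_smul₀ hm0, sub_self]

theorem newErr_eq (hb : 0 < b) (st : State q n) (i : Fin n) (J : Fin b → Fin m) :
    newErr M st i J = (st.loc i - M.sbarLocal i (M.T st.Sprev))
      + (b : ℝ)⁻¹ • ∑ r, incrDev M st i (J r) := by
  have hb0 : (b : ℝ) ≠ 0 := Nat.cast_ne_zero.2 hb.ne'
  simp only [newErr, newLoc, incrDev, Finset.sum_sub_distrib, Finset.sum_const, Finset.card_univ,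
    Fintype.card_fin, ← Nat.cast_smul_eq_nsmul ℝ, smul_sub, inv_smul_smul₀ hb0]
  abel

/-- Only the increments of `s ↦ s̄_ij(T(s)) - s` matter for the sampling variance: the identity
cancels when the mean over `j` is subtracted. -/
theorem sum_norm_incrDev_sq_le {Lip : Fin n → Fin m → ℝ} (hm : 0 < m)
    (hLip : M.IsLipschitzField Lip) (st : State q n) (i : Fin n) :
    ∑ j, ‖incrDev M st i j‖ ^ 2 ≤ (∑ j, Lip i j ^ 2) * sqIncr st := by
  have hm0 : (m : ℝ) ≠ 0 := Nat.cast_ne_zero.2 hm.ne'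
  have h := sum_norm_sub_mean_sq_le fun j =>
    (M.sbar i j (M.T st.S) - st.S) - (M.sbar i j (M.T st.Sprev) - st.Sprev)
  have heq : ∀ j, (M.sbar i j (M.T st.S) - st.S) - (M.sbar i j (M.T st.Sprev) - st.Sprev)
      - (m : ℝ)⁻¹ • ∑ j', ((M.sbar i j' (M.T st.S) - st.S)
        - (M.sbar i j' (M.T st.Sprev) - st.Sprev)) = incrDev M st i j := by
    intro j
    simp only [incrDev, EMModel.sbarLocal, Finset.sum_sub_distrib, Finset.sum_const,
      Finset.card_univ, Fintype.card_fin, ← Nat.cast_smul_eq_nsmul ℝ, smul_sub,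
      inv_smul_smul₀ hm0]
    abel
  simp_rw [heq] at h
  refine h.trans ?_
  rw [Finset.sum_mul]
  exact Finset.sum_le_sum fun j _ => hLip.sq_norm_sub_le i j _ _

theorem meanLip_sq (Lip : Fin n → Fin m → ℝ) :
    meanLip Lip ^ 2 = (n : ℝ)⁻¹ * ∑ i, (m : ℝ)⁻¹ * ∑ j, Lip i j ^ 2 := by
  rw [meanLip, Real.sq_sqrt (by positivity), ← Finset.mul_sum, mul_assoc]

theorem norm_hLocal_sub_sq_le {Lip : Fin n → Fin m → ℝ} (hm : 0 < m)
    (hLip : M.IsLipschitzField Lip) (i : Fin n) (s s' : Vec q) :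
    ‖M.hLocal i s - M.hLocal i s'‖ ^ 2 ≤ (m : ℝ)⁻¹ * (∑ j, Lip i j ^ 2) * ‖s - s'‖ ^ 2 := by
  have hm0 : (0 : ℝ) < m := Nat.cast_pos.2 hm
  have heq : M.hLocal i s - M.hLocal i s' = (m : ℝ)⁻¹ •
      ∑ j, ((M.sbar i j (M.T s) - s) - (M.sbar i j (M.T s') - s')) := by
    simp only [EMModel.hLocal, EMModel.sbarLocal, Finset.sum_sub_distrib, Finset.sum_const,
      Finset.card_univ, Fintype.card_fin, ← Nat.cast_smul_eq_nsmul ℝ, smul_sub,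
      inv_smul_smul₀ hm0.ne']
  rw [heq, norm_smul, Real.norm_of_nonneg (inv_nonneg.2 hm0.le), mul_pow]
  have h1 : ‖∑ j, ((M.sbar i j (M.T s) - s) - (M.sbar i j (M.T s') - s'))‖ ^ 2
      ≤ m * ((∑ j, Lip i j ^ 2) * ‖s - s'‖ ^ 2) := by
    calc _ ≤ (∑ j, ‖(M.sbar i j (M.T s) - s) - (M.sbar i j (M.T s') - s')‖) ^ 2 :=
          pow_le_pow_left₀ (norm_nonneg _) (norm_sum_le _ _) 2
      _ ≤ m * ∑ j, ‖(M.sbar i j (M.T s) - s) - (M.sbar i j (M.T s') - s')‖ ^ 2 := by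
          simpa using sq_sum_le_card_mul_sum_sq (s := (Finset.univ : Finset (Fin m)))
            (f := fun j => ‖(M.sbar i j (M.T s) - s) - (M.sbar i j (M.T s') - s')‖)
      _ ≤ _ := by
          rw [Finset.sum_mul]
          exact mul_le_mul_of_nonneg_left
            (Finset.sum_le_sum fun j _ => hLip.sq_norm_sub_le i j _ _) hm0.le
  calc _ ≤ (m : ℝ)⁻¹ ^ 2 * (m * ((∑ j, Lip i j ^ 2) * ‖s - s'‖ ^ 2)) :=
        mul_le_mul_of_nonneg_left h1 (by positivity)
    _ = _ := by field_simp

/-! ### Minibatch half-step -/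

section Batch

variable {sch : Sampling} {Lip : Fin n → Fin m → ℝ}

theorem integral_norm_batch_sq_le (hm : 0 < m) (hb : 0 < b)
    (hprob : IsProbabilityMeasure (uniformOn (sch.outcomes b m)))
    (hLip : M.IsLipschitzField Lip) (st : State q n) (i : Fin n) :
    ∫ J, ‖(b : ℝ)⁻¹ • ∑ r, incrDev M st i (J r)‖ ^ 2 ∂(uniformOn (sch.outcomes b m)) ≤
      (b : ℝ)⁻¹ * ((m : ℝ)⁻¹ * ∑ j, Lip i j ^ 2) * sqIncr st := by
  have hb0 : (0 : ℝ) < b := Nat.cast_pos.2 hb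
  have h := Sampling.integral_norm_sum_sq_le hm hprob (sum_incrDev (M := M) hm st i)
  have h2 := sum_norm_incrDev_sq_le hm hLip st i
  simp_rw [norm_smul, Real.norm_of_nonneg (inv_nonneg.2 hb0.le), mul_pow]
  rw [integral_const_mul]
  calc _ ≤ (b : ℝ)⁻¹ ^ 2 * (b * ((m : ℝ)⁻¹ * ((∑ j, Lip i j ^ 2) * sqIncr st))) := by
        refine mul_le_mul_of_nonneg_left (h.trans ?_) (by positivity)
        gcongr
    _ = _ := by field_simp

theorem integral_batch_eq_zero (hm : 0 < m)
    (hprob : IsProbabilityMeasure (uniformOn (sch.outcomes b m))) (st : State q n) (i : Fin n) :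
    ∫ J, (b : ℝ)⁻¹ • ∑ r, incrDev M st i (J r) ∂(uniformOn (sch.outcomes b m)) = 0 := by
  rw [integral_smul, Sampling.integral_sum_eq_zero hm hprob (sum_incrDev hm st i), smul_zero]

variable [IsProbabilityMeasure (uniformOn (sch.outcomes b m))]

theorem integral_newMeanSqErr_le (hm : 0 < m) (hb : 0 < b) (hLip : M.IsLipschitzField Lip)
    (st : State q n) :
    ∫ J, newMeanSqErr M st J ∂(Measure.pi fun _ : Fin n => uniformOn (sch.outcomes b m)) ≤
      meanSqErr M st + meanLip Lip ^ 2 / b * sqIncr st := by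
  have hprob : IsProbabilityMeasure (uniformOn (sch.outcomes b m)) := inferInstance
  simp only [newMeanSqErr, meanSqErr]
  rw [integral_const_mul, integral_finsetSum _ fun i _ => .of_finite]
  have h : ∀ i, ∫ J, ‖newErr M st i (J i)‖ ^ 2
      ∂(Measure.pi fun _ : Fin n => uniformOn (sch.outcomes b m)) ≤
      ‖st.loc i - M.sbarLocal i (M.T st.Sprev)‖ ^ 2
        + (b : ℝ)⁻¹ * ((m : ℝ)⁻¹ * ∑ j, Lip i j ^ 2) * sqIncr st := by
    intro i
    have := integral_norm_batch_sq_le hm hb hprob hLip st i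
    simp_rw [newErr_eq hb]
    rw [integral_pi_norm_const_add_sq (μ := fun _ : Fin n => uniformOn (sch.outcomes b m)) i
      (X := fun J : Fin b → Fin m => (b : ℝ)⁻¹ • ∑ r, incrDev M st i (J r)) .of_discrete,
      integral_batch_eq_zero hm hprob, inner_zero_right]
    linarith
  calc _ ≤ (n : ℝ)⁻¹ * ∑ i, (‖st.loc i - M.sbarLocal i (M.T st.Sprev)‖ ^ 2
        + (b : ℝ)⁻¹ * ((m : ℝ)⁻¹ * ∑ j, Lip i j ^ 2) * sqIncr st) := by
        gcongr with i
        exact h i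
    _ = _ := by
        rw [Finset.sum_add_distrib, meanLip_sq, ← Finset.sum_mul, ← Finset.mul_sum]
        ring

/-- Averaging over independent workers divides the sampling variance by `n`. -/
theorem integral_newSqMeanErr_le (hm : 0 < m) (hb : 0 < b) (hLip : M.IsLipschitzField Lip)
    (st : State q n) :
    ∫ J, newSqMeanErr M st J ∂(Measure.pi fun _ : Fin n => uniformOn (sch.outcomes b m)) ≤
      sqMeanErr M st + meanLip Lip ^ 2 / (n * b) * sqIncr st := by
  have hprob : IsProbabilityMeasure (uniformOn (sch.outcomes b m)) := inferInstance
  simp only [newSqMeanErr, sqMeanErr]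
  have heq : ∀ J : Fin n → Fin b → Fin m, (n : ℝ)⁻¹ • ∑ i, newErr M st i (J i)
      = (n : ℝ)⁻¹ • ∑ i, (st.loc i - M.sbarLocal i (M.T st.Sprev))
        + ∑ i, (n : ℝ)⁻¹ • (b : ℝ)⁻¹ • ∑ r, incrDev M st i (J i r) := by
    intro J
    simp_rw [newErr_eq hb]
    rw [Finset.sum_add_distrib, smul_add, Finset.smul_sum (s := Finset.univ)
      (f := fun i => (b : ℝ)⁻¹ • ∑ r, incrDev M st i (J i r))]
  simp_rw [heq]
  rw [integral_pi_norm_const_add_sum_sq (μ := fun _ : Fin n => uniformOn (sch.outcomes b m))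
    (X := fun i (J : Fin b → Fin m) => (n : ℝ)⁻¹ • (b : ℝ)⁻¹ • ∑ r, incrDev M st i (J r))
    (fun i => .of_discrete)]
  have h0 : ∀ i, ∫ J, (n : ℝ)⁻¹ • (b : ℝ)⁻¹ • ∑ r, incrDev M st i (J r)
      ∂(uniformOn (sch.outcomes b m)) = 0 := by
    intro i
    rw [integral_smul, integral_batch_eq_zero hm hprob, smul_zero]
  simp_rw [h0]
  have h1 : ∀ i, ∫ J, ‖(n : ℝ)⁻¹ • (b : ℝ)⁻¹ • ∑ r, incrDev M st i (J r)‖ ^ 2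
      ∂(uniformOn (sch.outcomes b m)) ≤
      (n : ℝ)⁻¹ ^ 2 * ((b : ℝ)⁻¹ * ((m : ℝ)⁻¹ * ∑ j, Lip i j ^ 2) * sqIncr st) := by
    intro i
    have := integral_norm_batch_sq_le hm hb hprob hLip st i
    simp_rw [norm_smul (n : ℝ)⁻¹, Real.norm_of_nonneg (inv_nonneg.2 (Nat.cast_nonneg n)), mul_pow]
    rw [integral_const_mul]
    gcongr
  simp only [Finset.sum_const_zero, add_zero, norm_zero, ne_eq, OfNat.ofNat_ne_zero,
    not_false_eq_true, zero_pow, sub_zero]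
  have h2 := Finset.sum_le_sum fun i (_ : i ∈ Finset.univ) => h1 i
  have h3 : ∑ i, (n : ℝ)⁻¹ ^ 2 * ((b : ℝ)⁻¹ * ((m : ℝ)⁻¹ * ∑ j, Lip i j ^ 2) * sqIncr st)
      = meanLip Lip ^ 2 / (n * b) * sqIncr st := by
    rw [meanLip_sq, ← Finset.mul_sum, ← Finset.sum_mul, ← Finset.mul_sum]
    field_simp
  linarith

end Batch

/-! ### Quantisation half-step -/

section Quantisation

variable {quant : Vec q → U → Vec q} {ω α : ℝ}

theorem delta_eq (st : State q n) (i : Fin n) (J : Fin b → Fin m) :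
    delta M st i J = newErr M st i J - (st.V i - M.hLocal i st.S) := by
  simp only [delta, newErr, EMModel.hLocal]
  abel

theorem mean_norm_delta_sq_le (st : State q n) (J : Fin n → Fin b → Fin m) :
    (n : ℝ)⁻¹ * ∑ i, ‖delta M st i (J i)‖ ^ 2 ≤
      3 / 2 * memoryError M st + 3 * newMeanSqErr M st J := by
  have h : ∀ i, ‖delta M st i (J i)‖ ^ 2 ≤
      3 / 2 * ‖st.V i - M.hLocal i st.S‖ ^ 2 + 3 * ‖newErr M st i (J i)‖ ^ 2 := by
    intro i
    rw [delta_eq]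
    have h1 := norm_sub_le (newErr M st i (J i)) (st.V i - M.hLocal i st.S)
    have h2 := pow_le_pow_left₀ (norm_nonneg _) h1 2
    nlinarith [sq_nonneg (2 * ‖newErr M st i (J i)‖ - ‖st.V i - M.hLocal i st.S‖)]
  calc _ ≤ (n : ℝ)⁻¹ * ∑ i, (3 / 2 * ‖st.V i - M.hLocal i st.S‖ ^ 2
        + 3 * ‖newErr M st i (J i)‖ ^ 2) := by
        gcongr with i
        exact h i
    _ = _ := by
        rw [Finset.sum_add_distrib, ← Finset.mul_sum, ← Finset.mul_sum, memoryError, newMeanSqErr]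
        ring

/-- The server memory is the mean of the local memories, hence the quantised field is unbiased up
to the error of the local statistics. -/
theorem add_mean_delta_eq (st : State q n) (hV : st.Vbar = (n : ℝ)⁻¹ • ∑ i, st.V i)
    (J : Fin n → Fin b → Fin m) :
    st.Vbar + (n : ℝ)⁻¹ • ∑ i, delta M st i (J i) =
      M.h st.S + (n : ℝ)⁻¹ • ∑ i, newErr M st i (J i) := by
  simp_rw [delta_eq, hV, EMModel.h, Finset.sum_sub_distrib, smul_sub]
  abel

/-- Young's inequality accounting for the displacement of the fields `h_i(Ŝ_{t,k})`. -/
theorem memoryError_step_le {Lip : Fin n → Fin m → ℝ} (hm : 0 < m)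
    (hLip : M.IsLipschitzField Lip) (hα : 0 < α) (γ : ℝ) (st : State q n)
    (J : Fin n → Fin b → Fin m) (u : Fin n → U) :
    memoryError M (step M quant α γ J u st) ≤
      (1 + α / 3) * ((n : ℝ)⁻¹ *
        ∑ i, ‖st.V i + α • quant (delta M st i (J i)) (u i) - M.hLocal i st.S‖ ^ 2)
      + (1 + 3 / α) * meanLip Lip ^ 2 * sqIncr (step M quant α γ J u st) := by
  have h : ∀ i, ‖(step M quant α γ J u st).V i - M.hLocal i (step M quant α γ J u st).S‖ ^ 2 ≤
      (1 + α / 3) * ‖st.V i + α • quant (delta M st i (J i)) (u i) - M.hLocal i st.S‖ ^ 2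
      + (1 + 3 / α) * (((m : ℝ)⁻¹ * ∑ j, Lip i j ^ 2) * sqIncr (step M quant α γ J u st)) := by
    intro i
    have h1 := norm_hLocal_sub_sq_le hm hLip i (step M quant α γ J u st).S st.S
    have h1' : ‖M.hLocal i (step M quant α γ J u st).S - M.hLocal i st.S‖ ^ 2
      ≤ ((m : ℝ)⁻¹ * ∑ j, Lip i j ^ 2) * sqIncr (step M quant α γ J u st) := h1
    have heq : (step M quant α γ J u st).V i - M.hLocal i (step M quant α γ J u st).S
        = (st.V i + α • quant (delta M st i (J i)) (u i) - M.hLocal i st.S)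
          - (M.hLocal i (step M quant α γ J u st).S - M.hLocal i st.S) := by
      simp only [step]
      abel
    rw [heq]
    set A := st.V i + α • quant (delta M st i (J i)) (u i) - M.hLocal i st.S
    set D := M.hLocal i (step M quant α γ J u st).S - M.hLocal i st.S
    have h2 := pow_le_pow_left₀ (norm_nonneg _) (norm_sub_le A D) 2
    have h3 : 2 * ‖A‖ * ‖D‖ ≤ α / 3 * ‖A‖ ^ 2 + 3 / α * ‖D‖ ^ 2 := by
      have : α / 3 * ‖A‖ ^ 2 + 3 / α * ‖D‖ ^ 2 - 2 * ‖A‖ * ‖D‖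
          = (α * ‖A‖ - 3 * ‖D‖) ^ 2 / (3 * α) := by
        field_simp
        ring
      have : 0 ≤ (α * ‖A‖ - 3 * ‖D‖) ^ 2 / (3 * α) := by positivity
      linarith
    have h4 := mul_le_mul_of_nonneg_left h1' (by positivity : 0 ≤ 1 + 3 / α)
    linarith
  rw [memoryError]
  calc _ ≤ (n : ℝ)⁻¹ * ∑ i, ((1 + α / 3) *
        ‖st.V i + α • quant (delta M st i (J i)) (u i) - M.hLocal i st.S‖ ^ 2
      + (1 + 3 / α) * (((m : ℝ)⁻¹ * ∑ j, Lip i j ^ 2) * sqIncr (step M quant α γ J u st))) := by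
        gcongr with i
        exact h i
    _ = _ := by
        rw [Finset.sum_add_distrib, meanLip_sq, ← Finset.mul_sum, ← Finset.mul_sum,
          ← Finset.sum_mul]
        ring

theorem sqIncr_step (γ : ℝ) (st : State q n) (J : Fin n → Fin b → Fin m) (u : Fin n → U) :
    sqIncr (step M quant α γ J u st) = γ ^ 2 * ‖fieldH M quant st J u‖ ^ 2 := by
  simp only [sqIncr, step, add_sub_cancel_left, norm_smul, mul_pow, Real.norm_eq_abs, sq_abs]

theorem W_step_le {LW vmin vmax γ : ℝ} (hLyap : M.IsLyapunov LW vmin vmax) (st : State q n)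
    (J : Fin n → Fin b → Fin m) (u : Fin n → U) :
    M.W (step M quant α γ J u st).S ≤ M.W st.S
      + γ * inner ℝ (gradient M.W st.S) (fieldH M quant st J u)
      + LW / 2 * sqIncr (step M quant α γ J u st) := by
  have h := le_quadratic_of_lipschitz_gradient hLyap.contDiff hLyap.lipschitz st.S
    (γ • fieldH M quant st J u)
  rw [real_inner_smul_right] at h
  rw [sqIncr]
  simpa [step] using h

variable [MeasurableSpace U] {ν : Measure U} [IsProbabilityMeasure ν]

theorem memLp_eval (hQuant : IsQuantizer quant ν ω) (x : Vec q) (i : Fin n) :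
    MemLp (fun u : Fin n → U => quant x (u i)) 2 (Measure.pi fun _ => ν) :=
  (hQuant.memLp x).comp_measurePreserving (measurePreserving_eval (fun _ : Fin n => ν) i)

theorem memLp_fieldH (hQuant : IsQuantizer quant ν ω) (st : State q n)
    (J : Fin n → Fin b → Fin m) :
    MemLp (fun u => fieldH M quant st J u) 2 (Measure.pi fun _ : Fin n => ν) := by
  have h1 : MemLp (fun u : Fin n → U => ∑ i, quant (delta M st i (J i)) (u i)) 2
      (Measure.pi fun _ => ν) :=
    memLp_finsetSum Finset.univ fun i _ => memLp_eval hQuant (delta M st i (J i)) i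
  exact (memLp_const st.Vbar).add (h1.const_smul (n : ℝ)⁻¹)

theorem integral_fieldH (hQuant : IsQuantizer quant ν ω) (st : State q n)
    (hV : st.Vbar = (n : ℝ)⁻¹ • ∑ i, st.V i) (J : Fin n → Fin b → Fin m) :
    ∫ u, fieldH M quant st J u ∂(Measure.pi fun _ : Fin n => ν) =
      M.h st.S + (n : ℝ)⁻¹ • ∑ i, newErr M st i (J i) := by
  have hint : ∀ i, Integrable (fun u : Fin n → U => quant (delta M st i (J i)) (u i))
      (Measure.pi fun _ => ν) := fun i => (memLp_eval hQuant _ i).integrable one_le_two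
  rw [← add_mean_delta_eq st hV]
  simp only [fieldH]
  have hint2 : Integrable (fun u : Fin n → U =>
      (n : ℝ)⁻¹ • ∑ i, quant (delta M st i (J i)) (u i)) (Measure.pi fun _ => ν) :=
    (integrable_finsetSum Finset.univ fun i _ => hint i).smul (n : ℝ)⁻¹
  rw [integral_add (integrable_const _) hint2, integral_smul,
    integral_finsetSum _ fun i _ => hint i]
  have h : ∀ i, ∫ u : Fin n → U, quant (delta M st i (J i)) (u i) ∂(Measure.pi fun _ => ν)
      = delta M st i (J i) := fun i => by
    rw [integral_comp_eval_pi (μ := fun _ : Fin n => ν) i (hQuant.memLp _).1, hQuant.unbiased]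
  simp [h]

theorem integral_norm_fieldH_sq_le (hQuant : IsQuantizer quant ν ω) (st : State q n)
    (hV : st.Vbar = (n : ℝ)⁻¹ • ∑ i, st.V i) (J : Fin n → Fin b → Fin m) :
    ∫ u, ‖fieldH M quant st J u‖ ^ 2 ∂(Measure.pi fun _ : Fin n => ν) ≤
      ‖M.h st.S + (n : ℝ)⁻¹ • ∑ i, newErr M st i (J i)‖ ^ 2
        + ω / n * (3 / 2 * memoryError M st + 3 * newMeanSqErr M st J) := by
  have hnn : (0 : ℝ) ≤ (n : ℝ)⁻¹ := inv_nonneg.2 (Nat.cast_nonneg n)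
  simp only [fieldH, Finset.smul_sum]
  rw [integral_pi_norm_const_add_sum_sq (μ := fun _ : Fin n => ν)
    (X := fun i u => (n : ℝ)⁻¹ • quant (delta M st i (J i)) u)
    (fun i => (hQuant.memLp (delta M st i (J i))).const_smul (n : ℝ)⁻¹)]
  simp_rw [integral_smul, hQuant.unbiased]
  rw [← Finset.smul_sum, ← Finset.smul_sum, add_mean_delta_eq st hV]
  have h : ∀ i, ∫ u, ‖(n : ℝ)⁻¹ • quant (delta M st i (J i)) u‖ ^ 2 ∂ν
      - ‖(n : ℝ)⁻¹ • delta M st i (J i)‖ ^ 2 ≤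
      (n : ℝ)⁻¹ ^ 2 * ω * ‖delta M st i (J i)‖ ^ 2 := by
    intro i
    simp_rw [norm_smul, Real.norm_of_nonneg hnn, mul_pow]
    rw [integral_const_mul]
    have := mul_le_mul_of_nonneg_left (hQuant.second_moment (delta M st i (J i)))
      (pow_nonneg hnn 2)
    linarith
  have h2 := Finset.sum_le_sum fun i (_ : i ∈ Finset.univ) => h i
  rw [← Finset.mul_sum] at h2
  have h3 := mul_le_mul_of_nonneg_left (mean_norm_delta_sq_le (M := M) st J)
    (mul_nonneg hnn hQuant.omega_nonneg)
  have h4 : ω / n = (n : ℝ)⁻¹ * ω := by rw [div_eq_mul_inv, mul_comm]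
  rw [h4]
  linarith

theorem integrable_memory_update (hQuant : IsQuantizer quant ν ω) (st : State q n)
    (J : Fin n → Fin b → Fin m) :
    Integrable (fun u => (n : ℝ)⁻¹ *
      ∑ i, ‖st.V i + α • quant (delta M st i (J i)) (u i) - M.hLocal i st.S‖ ^ 2)
      (Measure.pi fun _ : Fin n => ν) := by
  have h : ∀ i, MemLp (fun u : Fin n → U =>
      st.V i + α • quant (delta M st i (J i)) (u i) - M.hLocal i st.S) 2
      (Measure.pi fun _ => ν) := fun i =>
    ((memLp_const (st.V i)).add ((memLp_eval hQuant (delta M st i (J i)) i).const_smul α)).sub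
      (memLp_const (M.hLocal i st.S))
  exact (integrable_finsetSum Finset.univ fun i _ =>
    (h i).integrable_norm_pow two_ne_zero).const_mul (n : ℝ)⁻¹

/-- Contraction of the memories towards the fields `h_i(Ŝ_{t,k})`, for `α = 1 / (1 + ω)`. -/
theorem integral_memory_update_le (hQuant : IsQuantizer quant ν ω) (hα : α = 1 / (1 + ω))
    (st : State q n) (J : Fin n → Fin b → Fin m) :
    ∫ u, (n : ℝ)⁻¹ * ∑ i, ‖st.V i + α • quant (delta M st i (J i)) (u i) - M.hLocal i st.S‖ ^ 2
        ∂(Measure.pi fun _ : Fin n => ν) ≤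
      (1 - α) * memoryError M st + α * newMeanSqErr M st J := by
  have hω : 0 < 1 + ω := by linarith [hQuant.omega_nonneg]
  have hα0 : 0 ≤ α := hα ▸ (one_div_pos.2 hω).le
  have hmem : ∀ i, MemLp (fun u => α • quant (delta M st i (J i)) u) 2 ν :=
    fun i => (hQuant.memLp (delta M st i (J i))).const_smul α
  have heq : ∀ i (u : Fin n → U), st.V i + α • quant (delta M st i (J i)) (u i) - M.hLocal i st.S
      = (st.V i - M.hLocal i st.S) + α • quant (delta M st i (J i)) (u i) := by
    intro i u
    abel
  simp_rw [heq]
  have hint : ∀ i, Integrable (fun u : Fin n → U =>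
      ‖(st.V i - M.hLocal i st.S) + α • quant (delta M st i (J i)) (u i)‖ ^ 2)
      (Measure.pi fun _ => ν) := fun i =>
    ((memLp_const (st.V i - M.hLocal i st.S)).add
      ((memLp_eval hQuant (delta M st i (J i)) i).const_smul α)).integrable_norm_pow two_ne_zero
  rw [integral_const_mul, integral_finsetSum _ fun i _ => hint i]
  have h : ∀ i, ∫ u : Fin n → U,
      ‖(st.V i - M.hLocal i st.S) + α • quant (delta M st i (J i)) (u i)‖ ^ 2
        ∂(Measure.pi fun _ => ν) ≤
      (1 - α) * ‖st.V i - M.hLocal i st.S‖ ^ 2 + α * ‖newErr M st i (J i)‖ ^ 2 := by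
    intro i
    rw [integral_pi_norm_const_add_sq (μ := fun _ : Fin n => ν) i (hmem i), integral_smul,
      hQuant.unbiased, real_inner_smul_right]
    simp_rw [norm_smul, Real.norm_of_nonneg hα0, mul_pow]
    rw [integral_const_mul]
    have h1 := mul_le_mul_of_nonneg_left (hQuant.second_moment (delta M st i (J i)))
      (pow_nonneg hα0 2)
    -- `α² (1 + ω) = α`
    have h2 : α ^ 2 * ((1 + ω) * ‖delta M st i (J i)‖ ^ 2) = α * ‖delta M st i (J i)‖ ^ 2 := by
      rw [hα]
      field_simp
    rw [h2, delta_eq, norm_sub_sq_real] at h1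
    rw [delta_eq, inner_sub_right, real_inner_self_eq_norm_sq]
    have h3 := real_inner_comm (newErr M st i (J i)) (st.V i - M.hLocal i st.S)
    rw [h3]
    linarith
  calc _ ≤ (n : ℝ)⁻¹ * ∑ i, ((1 - α) * ‖st.V i - M.hLocal i st.S‖ ^ 2
        + α * ‖newErr M st i (J i)‖ ^ 2) := by
        gcongr with i
        exact h i
    _ = _ := by
        rw [Finset.sum_add_distrib, ← Finset.mul_sum, ← Finset.mul_sum, memoryError, newMeanSqErr]
        ring

theorem integrable_sqIncr_step (hQuant : IsQuantizer quant ν ω) (γ : ℝ) (st : State q n)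
    (J : Fin n → Fin b → Fin m) :
    Integrable (fun u => sqIncr (step M quant α γ J u st)) (Measure.pi fun _ : Fin n => ν) := by
  simp_rw [sqIncr_step]
  exact ((memLp_fieldH hQuant st J).integrable_norm_pow two_ne_zero).const_mul _

theorem integral_sqIncr_step_le (hQuant : IsQuantizer quant ν ω) (γ : ℝ)
    (st : State q n) (hV : st.Vbar = (n : ℝ)⁻¹ • ∑ i, st.V i) (J : Fin n → Fin b → Fin m) :
    ∫ u, sqIncr (step M quant α γ J u st) ∂(Measure.pi fun _ : Fin n => ν) ≤
      γ ^ 2 * (4 / 3 * ‖M.h st.S‖ ^ 2 + 4 * newSqMeanErr M st J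
        + ω / n * (3 / 2 * memoryError M st + 3 * newMeanSqErr M st J)) := by
  simp_rw [sqIncr_step]
  rw [integral_const_mul]
  refine mul_le_mul_of_nonneg_left
    ((integral_norm_fieldH_sq_le hQuant st hV J).trans ?_) (sq_nonneg γ)
  rw [newSqMeanErr]
  set e := (n : ℝ)⁻¹ • ∑ i, newErr M st i (J i)
  have h1 := pow_le_pow_left₀ (norm_nonneg _) (norm_add_le (M.h st.S) e) 2
  nlinarith [sq_nonneg (‖M.h st.S‖ - 3 * ‖e‖)]

section Descent

variable {LW vmin vmax γ : ℝ}

theorem integrable_W_step (hQuant : IsQuantizer quant ν ω) (hLyap : M.IsLyapunov LW vmin vmax)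
    (hBdd : BddBelow (Set.range M.W)) (st : State q n) (J : Fin n → Fin b → Fin m) :
    Integrable (fun u => M.W (step M quant α γ J u st).S - ⨅ s, M.W s)
      (Measure.pi fun _ : Fin n => ν) := by
  have hH := memLp_fieldH (M := M) hQuant st J
  have hmeas : AEStronglyMeasurable (fun u => M.W (step M quant α γ J u st).S - ⨅ s, M.W s)
      (Measure.pi fun _ : Fin n => ν) := by
    have h1 : AEStronglyMeasurable (fun u => st.S + γ • fieldH M quant st J u)
        (Measure.pi fun _ : Fin n => ν) := (hH.1.const_smul γ).const_add st.S
    exact (hLyap.contDiff.continuous.comp_aestronglyMeasurable h1).sub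
      aestronglyMeasurable_const
  refine ((((integrable_const (M.W st.S - ⨅ s, M.W s)).add
    (((hH.integrable one_le_two).const_inner (gradient M.W st.S)).const_mul γ)).add
    ((integrable_sqIncr_step (M := M) (α := α) hQuant γ st J).const_mul (LW / 2)))).mono' hmeas
    (ae_of_all _ fun u => ?_)
  rw [Real.norm_of_nonneg (sub_nonneg.2 (ciInf_le hBdd _))]
  have := W_step_le (α := α) (γ := γ) (quant := quant) hLyap st J u
  simp only [Pi.add_apply]
  linarith

/-- Expected decrease of `W`. The part `(vmin / (2γ) - LW / 2) ‖Ŝ_{t,k+1} - Ŝ_{t,k}‖²` of the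
decrease that is not consumed by the quadratic term of the descent lemma is kept. -/
theorem integral_W_step_le (hQuant : IsQuantizer quant ν ω)
    (hLyap : M.IsLyapunov LW vmin vmax) (hBdd : BddBelow (Set.range M.W)) (hγ : 0 < γ)
    (st : State q n) (hV : st.Vbar = (n : ℝ)⁻¹ • ∑ i, st.V i) (J : Fin n → Fin b → Fin m) :
    ∫ u, ((M.W (step M quant α γ J u st).S - ⨅ s, M.W s)
        + (vmin / (2 * γ) - LW / 2) * sqIncr (step M quant α γ J u st))
        ∂(Measure.pi fun _ : Fin n => ν) ≤
      (M.W st.S - ⨅ s, M.W s) - γ * vmin / 2 * ‖M.h st.S‖ ^ 2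
        + γ * vmax / 2 * newSqMeanErr M st J
        + γ * vmin / 2 * (ω / n * (3 / 2 * memoryError M st + 3 * newMeanSqErr M st J)) := by
  have hH := memLp_fieldH (M := M) hQuant st J
  have hI1 : Integrable (fun u => γ * inner ℝ (gradient M.W st.S) (fieldH M quant st J u))
      (Measure.pi fun _ : Fin n => ν) :=
    (((hH.integrable one_le_two).const_inner (gradient M.W st.S)).const_mul γ)
  have hI2 := (hH.integrable_norm_pow two_ne_zero)
  have hI3 : Integrable (fun u => γ * vmin / 2 * ‖fieldH M quant st J u‖ ^ 2)
      (Measure.pi fun _ : Fin n => ν) := hI2.const_mul _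
  have hI4 : Integrable (fun u => (M.W st.S - ⨅ s, M.W s)
      + γ * inner ℝ (gradient M.W st.S) (fieldH M quant st J u))
      (Measure.pi fun _ : Fin n => ν) := (integrable_const _).add hI1
  calc _ ≤ ∫ u, ((M.W st.S - ⨅ s, M.W s)
        + γ * inner ℝ (gradient M.W st.S) (fieldH M quant st J u)
        + γ * vmin / 2 * ‖fieldH M quant st J u‖ ^ 2) ∂(Measure.pi fun _ : Fin n => ν) := by
        refine integral_mono ((integrable_W_step (M := M) (α := α) hQuant hLyap hBdd st J).add
          ((integrable_sqIncr_step (M := M) (α := α) hQuant γ st J).const_mul _))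
          (hI4.add hI3) fun u => ?_
        have h1 := W_step_le (α := α) (γ := γ) (quant := quant) hLyap st J u
        have h2 : vmin / (2 * γ) * sqIncr (step M quant α γ J u st)
            = γ * vmin / 2 * ‖fieldH M quant st J u‖ ^ 2 := by
          rw [sqIncr_step]
          field_simp
        simp only
        linarith
    _ = (M.W st.S - ⨅ s, M.W s) + γ * inner ℝ (gradient M.W st.S)
          (M.h st.S + (n : ℝ)⁻¹ • ∑ i, newErr M st i (J i))
        + γ * vmin / 2 * ∫ u, ‖fieldH M quant st J u‖ ^ 2 ∂(Measure.pi fun _ : Fin n => ν) := by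
        rw [integral_add hI4 hI3, integral_add (integrable_const _) hI1, integral_const_mul,
          integral_const_mul, integral_inner (hH.integrable one_le_two),
          integral_fieldH hQuant st hV]
        simp
    _ ≤ _ := by
        have h1 := mul_le_mul_of_nonneg_left
          (hLyap.inner_gradient_le st.S ((n : ℝ)⁻¹ • ∑ i, newErr M st i (J i))) hγ.le
        have h2 := mul_le_mul_of_nonneg_left (integral_norm_fieldH_sq_le (M := M) hQuant st hV J)
          (by have := hLyap.vmin_pos; positivity : 0 ≤ γ * vmin / 2)
        rw [newSqMeanErr]
        linarith

end Descent

end Quantisation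

end OneStep

/-! ### Measurability of the trajectory -/

section Measurability

variable {d q n m b : ℕ} {Y Z U : Type*} [MeasurableSpace Z] {M : EMModel d q n m Y Z}

/-- The σ-algebra on the states of the algorithm generated by their components. -/
instance : MeasurableSpace (State q n) :=
  MeasurableSpace.comap (fun st => (st.Sprev, st.S, st.loc, st.V, st.Vbar)) inferInstance

theorem State.measurable_toTuple :
    Measurable fun st : State q n => (st.Sprev, st.S, st.loc, st.V, st.Vbar) :=
  comap_measurable _

@[fun_prop]
theorem State.measurable_Sprev : Measurable (State.Sprev : State q n → Vec q) :=
  measurable_fst.comp State.measurable_toTuple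

@[fun_prop]
theorem State.measurable_S : Measurable (State.S : State q n → Vec q) :=
  (measurable_fst.comp measurable_snd).comp State.measurable_toTuple

@[fun_prop]
theorem State.measurable_loc : Measurable (State.loc : State q n → Fin n → Vec q) :=
  (measurable_fst.comp (measurable_snd.comp measurable_snd)).comp State.measurable_toTuple

@[fun_prop]
theorem State.measurable_V : Measurable (State.V : State q n → Fin n → Vec q) :=
  (measurable_fst.comp (measurable_snd.comp (measurable_snd.comp measurable_snd))).comp
    State.measurable_toTuple

@[fun_prop]
theorem State.measurable_Vbar : Measurable (State.Vbar : State q n → Vec q) :=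
  (measurable_snd.comp (measurable_snd.comp (measurable_snd.comp measurable_snd))).comp
    State.measurable_toTuple

theorem State.measurable_of_components {A : Type*} [MeasurableSpace A] {f : A → State q n}
    (h1 : Measurable fun a => (f a).Sprev) (h2 : Measurable fun a => (f a).S)
    (h3 : Measurable fun a => (f a).loc) (h4 : Measurable fun a => (f a).V)
    (h5 : Measurable fun a => (f a).Vbar) : Measurable f :=
  measurable_comap_iff.2 (h1.prodMk (h2.prodMk (h3.prodMk (h4.prodMk h5))))

variable {A : Type*} [MeasurableSpace A] {Lip : Fin n → Fin m → ℝ}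

theorem measurable_newLoc (hLip : M.IsLipschitzField Lip) {st : A → State q n}
    (hst : Measurable st) {J : A → Fin b → Fin m} (hJ : Measurable J) (i : Fin n) :
    Measurable fun a => newLoc M (st a) i (J a) := by
  have hsb : Measurable fun z : Fin m × Vec q => M.sbar i z.1 (M.T z.2) :=
    measurable_from_prod_countable_right fun j => (hLip.continuous_sbar i j).measurable
  have hJr : ∀ r, Measurable fun a => J a r := fun r => (measurable_pi_apply r).comp hJ
  have h1 : ∀ r, Measurable fun a => M.sbar i (J a r) (M.T (st a).S) := fun r =>
    hsb.comp ((hJr r).prodMk (by fun_prop : Measurable fun a => (st a).S))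
  have h2 : ∀ r, Measurable fun a => M.sbar i (J a r) (M.T (st a).Sprev) := fun r =>
    hsb.comp ((hJr r).prodMk (by fun_prop : Measurable fun a => (st a).Sprev))
  have h3 : Measurable fun a => (st a).loc i := by fun_prop
  exact h3.add ((Finset.measurable_sum Finset.univ fun r _ =>
    (h1 r).sub (h2 r)).const_smul (b : ℝ)⁻¹)

variable [MeasurableSpace U] {quant : Vec q → U → Vec q} {α : ℝ}

theorem measurable_step (hLip : M.IsLipschitzField Lip)
    (hquant : Measurable (Function.uncurry quant)) (γ : ℝ) {st : A → State q n}
    (hst : Measurable st) {J : A → Fin n → Fin b → Fin m} (hJ : Measurable J)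
    {u : A → Fin n → U} (hu : Measurable u) :
    Measurable fun a => step M quant α γ (J a) (u a) (st a) := by
  have hloc : ∀ i, Measurable fun a => newLoc M (st a) i (J a i) := fun i =>
    measurable_newLoc hLip hst ((measurable_pi_apply i).comp hJ) i
  have hV : ∀ i, Measurable fun a => (st a).V i := fun i => by fun_prop
  have hS : Measurable fun a => (st a).S := by fun_prop
  have hVbar : Measurable fun a => (st a).Vbar := by fun_prop
  have hQ : ∀ i, Measurable fun a => quant (delta M (st a) i (J a i)) (u a i) := fun i =>
    hquant.comp ((((hloc i).sub hS).sub (hV i)).prodMk ((measurable_pi_apply i).comp hu))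
  have hsum : Measurable fun a => ∑ i, quant (delta M (st a) i (J a i)) (u a i) :=
    Finset.measurable_sum Finset.univ fun i _ => hQ i
  refine State.measurable_of_components hS ?_ (measurable_pi_lambda _ hloc)
    (measurable_pi_lambda _ fun i => (hV i).add ((hQ i).const_smul α))
    (hVbar.add (hsum.const_smul (α * (n : ℝ)⁻¹)))
  exact hS.add ((hVbar.add (hsum.const_smul (n : ℝ)⁻¹)).const_smul γ)

theorem measurable_innerLoop (hLip : M.IsLipschitzField Lip)
    (hquant : Measurable (Function.uncurry quant)) (γ : ℕ → ℝ) {st : A → State q n}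
    (hst : Measurable st) {J : ℕ → Fin n → A → Fin b → Fin m} {u : ℕ → Fin n → A → U} (k : ℕ)
    (hJ : ∀ k' < k, ∀ i, Measurable (J k' i)) (hu : ∀ k' < k, ∀ i, Measurable (u k' i)) :
    Measurable fun a =>
      innerLoop M quant α γ (fun k i => J k i a) (fun k i => u k i a) (st a) k := by
  induction k with
  | zero => exact hst
  | succ k ih =>
    exact measurable_step hLip hquant (γ k)
      (ih (fun k' h => hJ k' (h.trans k.lt_succ_self)) (fun k' h => hu k' (h.trans k.lt_succ_self)))
      (measurable_pi_lambda _ fun i => hJ k k.lt_succ_self i)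
      (measurable_pi_lambda _ fun i => hu k k.lt_succ_self i)

theorem measurable_run (hLip : M.IsLipschitzField Lip)
    (hquant : Measurable (Function.uncurry quant)) (γ : ℕ → ℕ → ℝ) (kin : ℕ)
    {S₀ : A → Vec q} (hS₀ : Measurable S₀) {V₀ : A → Fin n → Vec q} (hV₀ : Measurable V₀)
    {J : ℕ → ℕ → Fin n → A → Fin b → Fin m} {u : ℕ → ℕ → Fin n → A → U} (t k : ℕ)
    (hJ : ∀ t' k', (t' < t ∧ k' < kin) ∨ (t' = t ∧ k' < k) → ∀ i, Measurable (J t' k' i))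
    (hu : ∀ t' k', (t' < t ∧ k' < kin) ∨ (t' = t ∧ k' < k) → ∀ i, Measurable (u t' k' i)) :
    Measurable fun a => run M quant α γ kin (fun t k i => J t k i a) (fun t k i => u t k i a)
      (S₀ a) (V₀ a) t k := by
  have hloc : ∀ {S : A → Vec q}, Measurable S →
      Measurable fun a i => M.sbarLocal i (M.T (S a)) := fun hS =>
    measurable_pi_lambda _ fun i => (hLip.continuous_sbarLocal i).measurable.comp hS
  have hout : ∀ t', t' ≤ t → Measurable fun a => outerLoop M quant α γ kin
      (fun t k i => J t k i a) (fun t k i => u t k i a) (S₀ a) (V₀ a) t' := by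
    intro t' ht'
    induction t' with
    | zero =>
      have hVi : ∀ i, Measurable fun a => V₀ a i := fun i => (measurable_pi_apply i).comp hV₀
      exact State.measurable_of_components hS₀ hS₀ (hloc hS₀) hV₀
        ((Finset.measurable_sum Finset.univ fun i _ => hVi i).const_smul (n : ℝ)⁻¹)
    | succ t' ih =>
      have h := measurable_innerLoop (α := α) hLip hquant (γ t') (ih (by omega)) (J := J t')
        (u := u t') kin (fun k' hk' => hJ t' k' (.inl ⟨by omega, hk'⟩))
        (fun k' hk' => hu t' k' (.inl ⟨by omega, hk'⟩))
      have hS := State.measurable_S.comp h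
      have hV := State.measurable_V.comp h
      have hVbar := State.measurable_Vbar.comp h
      exact State.measurable_of_components hS hS (hloc hS) hV hVbar
  exact measurable_innerLoop hLip hquant (γ t) (hout t le_rfl) k
    (fun k' hk' => hJ t k' (.inr ⟨rfl, hk'⟩)) (fun k' hk' => hu t k' (.inr ⟨rfl, hk'⟩))

theorem measurable_memoryError (hLip : M.IsLipschitzField Lip) :
    Measurable (memoryError M : State q n → ℝ) := by
  have h : ∀ i, Measurable fun st : State q n => M.hLocal i st.S := fun i =>
    (hLip.continuous_hLocal i).measurable.comp State.measurable_S
  unfold memoryError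
  fun_prop

theorem measurable_newErr (hLip : M.IsLipschitzField Lip) (i : Fin n) :
    Measurable fun z : State q n × (Fin n → Fin b → Fin m) => newErr M z.1 i (z.2 i) := by
  have h : Measurable fun st : State q n => M.sbarLocal i (M.T st.S) :=
    (hLip.continuous_sbarLocal i).measurable.comp State.measurable_S
  exact (measurable_newLoc hLip measurable_fst ((measurable_pi_apply i).comp measurable_snd) i).sub
    (h.comp measurable_fst)

theorem measurable_newMeanSqErr (hLip : M.IsLipschitzField Lip) :
    Measurable fun z : State q n × (Fin n → Fin b → Fin m) => newMeanSqErr M z.1 z.2 := by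
  have h := fun i => measurable_newErr (M := M) (b := b) hLip i
  unfold newMeanSqErr
  fun_prop

theorem measurable_newSqMeanErr (hLip : M.IsLipschitzField Lip) :
    Measurable fun z : State q n × (Fin n → Fin b → Fin m) => newSqMeanErr M z.1 z.2 := by
  have h := fun i => measurable_newErr (M := M) (b := b) hLip i
  have h2 : Measurable fun z : State q n × (Fin n → Fin b → Fin m) =>
      (n : ℝ)⁻¹ • ∑ i, newErr M z.1 i (z.2 i) :=
    (Finset.measurable_sum Finset.univ fun i _ => h i).const_smul (n : ℝ)⁻¹
  exact h2.norm.pow_const 2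

theorem measurable_sqIncr : Measurable (sqIncr : State q n → ℝ) := by
  unfold sqIncr
  fun_prop

end Measurability

/-! ### Expected evolution over one iteration -/

section Expectation

variable {d q n m b : ℕ} {Y Z U Ω : Type*} [MeasurableSpace Z] [MeasurableSpace U]
  [MeasurableSpace Ω] (M : EMModel d q n m Y Z)

/-- The excess `W(Ŝ) - inf W`. -/
def excess (st : State q n) : ℝ := M.W st.S - ⨅ s, M.W s

/-- The random state `X` has finite expected excess, memory error and estimation errors. -/
structure HasMoments (P : Measure Ω) (X : Ω → State q n) : Prop where
  measurable : Measurable X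
  integrable_memory : Integrable (fun w => memoryError M (X w)) P
  integrable_excess : Integrable (fun w => excess M (X w)) P
  integrable_meanSqErr : Integrable (fun w => meanSqErr M (X w)) P
  integrable_sqMeanErr : Integrable (fun w => sqMeanErr M (X w)) P
  integrable_sqIncr : Integrable (fun w => sqIncr (X w)) P

variable {M} {P : Measure Ω} {Lip : Fin n → Fin m → ℝ} {LW vmin vmax : ℝ}

theorem excess_nonneg (hBdd : BddBelow (Set.range M.W)) (st : State q n) : 0 ≤ excess M st :=
  sub_nonneg.2 (ciInf_le hBdd _)

theorem memoryError_nonneg (st : State q n) : 0 ≤ memoryError M st := by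
  unfold memoryError
  positivity

theorem newMeanSqErr_nonneg (st : State q n) (J : Fin n → Fin b → Fin m) :
    0 ≤ newMeanSqErr M st J := by
  unfold newMeanSqErr
  positivity

theorem HasMoments.integrable_norm_h_sq {X : Ω → State q n} (hX : HasMoments M P X)
    (hLip : M.IsLipschitzField Lip) (hLyap : M.IsLyapunov LW vmin vmax)
    (hBdd : BddBelow (Set.range M.W)) : Integrable (fun w => ‖M.h (X w).S‖ ^ 2) P := by
  refine (hX.integrable_excess.const_mul (2 * LW / vmin ^ 2)).mono' ?_ (ae_of_all _ fun w => ?_)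
  · have h : Measurable fun w => M.h (X w).S :=
      hLip.continuous_h.measurable.comp (State.measurable_S.comp hX.measurable)
    exact (h.norm.pow_const 2).aestronglyMeasurable
  · rw [Real.norm_of_nonneg (sq_nonneg _)]
    exact hLyap.norm_h_sq_le hBdd _

/-- The expected evolution of the errors, the increment, the memory error and the excess of `W`
over one iteration whose randomness is fresh. -/
theorem HasMoments.step [IsProbabilityMeasure P] (hm : 0 < m) (hb : 0 < b)
    (hLip : M.IsLipschitzField Lip) (hLyap : M.IsLyapunov LW vmin vmax)
    (hBdd : BddBelow (Set.range M.W)) {ν : Measure U} [IsProbabilityMeasure ν]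
    {quant : Vec q → U → Vec q} {ω α γ : ℝ} (hQuant : IsQuantizer quant ν ω)
    (hα : α = 1 / (1 + ω)) (hγ : 0 < γ) (hγLW : γ * LW ≤ vmin) {sch : Sampling}
    [IsProbabilityMeasure (uniformOn (sch.outcomes b m))]
    {X : Ω → State q n} (hX : HasMoments M P X)
    (hV : ∀ w, (X w).Vbar = (n : ℝ)⁻¹ • ∑ i, (X w).V i)
    {J : Ω → Fin n → Fin b → Fin m} (hJ : Measurable J) {u : Ω → Fin n → U} (hu : Measurable u)
    (hJlaw : P.map J = Measure.pi fun _ => uniformOn (sch.outcomes b m))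
    (hulaw : P.map u = Measure.pi fun _ => ν)
    (hXJ : IndepFun X J P) (hXJu : IndepFun (fun w => (X w, J w)) u P)
    {X' : Ω → State q n} (hX' : ∀ w, X' w = step M quant α γ (J w) (u w) (X w)) :
    HasMoments M P X' ∧
      ∫ w, meanSqErr M (X' w) ∂P ≤
        ∫ w, meanSqErr M (X w) ∂P + meanLip Lip ^ 2 / b * ∫ w, sqIncr (X w) ∂P ∧
      ∫ w, sqMeanErr M (X' w) ∂P ≤
        ∫ w, sqMeanErr M (X w) ∂P + meanLip Lip ^ 2 / (n * b) * ∫ w, sqIncr (X w) ∂P ∧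
      ∫ w, sqIncr (X' w) ∂P ≤
        γ ^ 2 * (4 / 3 * ∫ w, ‖M.h (X w).S‖ ^ 2 ∂P + 4 * ∫ w, sqMeanErr M (X' w) ∂P
          + ω / n * (3 / 2 * ∫ w, memoryError M (X w) ∂P + 3 * ∫ w, meanSqErr M (X' w) ∂P)) ∧
      ∫ w, memoryError M (X' w) ∂P ≤
        (1 + α / 3) * ((1 - α) * ∫ w, memoryError M (X w) ∂P + α * ∫ w, meanSqErr M (X' w) ∂P)
          + (1 + 3 / α) * meanLip Lip ^ 2 * ∫ w, sqIncr (X' w) ∂P ∧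
      ∫ w, excess M (X' w) ∂P + (vmin / (2 * γ) - LW / 2) * ∫ w, sqIncr (X' w) ∂P ≤
        ∫ w, excess M (X w) ∂P - γ * vmin / 2 * ∫ w, ‖M.h (X w).S‖ ^ 2 ∂P
          + γ * vmax / 2 * ∫ w, sqMeanErr M (X' w) ∂P
          + γ * vmin / 2 * (ω / n *
            (3 / 2 * ∫ w, memoryError M (X w) ∂P + 3 * ∫ w, meanSqErr M (X' w) ∂P)) := by
  have hω : 0 < 1 + ω := by linarith [hQuant.omega_nonneg]
  have hα0 : 0 < α := hα ▸ one_div_pos.2 hω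
  have hh := hX.integrable_norm_h_sq hLip hLyap hBdd
  have hX'm : Measurable X' := by
    have := measurable_step (α := α) hLip hQuant.measurable γ hX.measurable hJ hu
    exact (funext hX') ▸ this
  have hstepm : Measurable fun z : (State q n × (Fin n → Fin b → Fin m)) × (Fin n → U) =>
      VRFedEM.step M quant α γ z.1.2 z.2 z.1.1 :=
    measurable_step hLip hQuant.measurable γ (measurable_fst.comp measurable_fst)
      (measurable_snd.comp measurable_fst) measurable_snd
  have hXJm : Measurable fun w => (X w, J w) := hX.measurable.prodMk hJ
  -- Average over the minibatches, given the state.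
  obtain ⟨he, hele⟩ := integrable_and_integral_le_of_indepFun hX.measurable hJ hXJ hJlaw
    (f := fun z => newMeanSqErr M z.1 z.2) (measurable_newMeanSqErr hLip)
    (fun z => newMeanSqErr_nonneg _ _)
    (φ := fun st => meanSqErr M st + meanLip Lip ^ 2 / b * sqIncr st)
    (hX.integrable_meanSqErr.add (hX.integrable_sqIncr.const_mul _)) (fun w => .of_finite)
    (fun w => integral_newMeanSqErr_le hm hb hLip (X w))
  obtain ⟨hbar, hbarle⟩ := integrable_and_integral_le_of_indepFun hX.measurable hJ hXJ hJlaw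
    (f := fun z => newSqMeanErr M z.1 z.2) (measurable_newSqMeanErr hLip)
    (fun z => sq_nonneg _)
    (φ := fun st => sqMeanErr M st + meanLip Lip ^ 2 / (n * b) * sqIncr st)
    (hX.integrable_sqMeanErr.add (hX.integrable_sqIncr.const_mul _)) (fun w => .of_finite)
    (fun w => integral_newSqMeanErr_le hm hb hLip (X w))
  rw [integral_add hX.integrable_meanSqErr (hX.integrable_sqIncr.const_mul _),
    integral_const_mul] at hele
  rw [integral_add hX.integrable_sqMeanErr (hX.integrable_sqIncr.const_mul _),
    integral_const_mul] at hbarle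
  have he_eq : ∀ w, meanSqErr M (X' w) = newMeanSqErr M (X w) (J w) := fun w => by
    rw [hX' w]
    rfl
  have hbar_eq : ∀ w, sqMeanErr M (X' w) = newSqMeanErr M (X w) (J w) := fun w => by
    rw [hX' w]
    rfl
  simp_rw [← he_eq] at he hele
  simp_rw [← hbar_eq] at hbar hbarle
  -- Average over the quantisation noises, given the state and the minibatches.
  have hVar : Integrable (fun w => ω / n *
      (3 / 2 * memoryError M (X w) + 3 * newMeanSqErr M (X w) (J w))) P := by
    simp_rw [← he_eq]
    exact ((hX.integrable_memory.const_mul _).add (he.const_mul _)).const_mul _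
  have hVar_eq : ∫ w, ω / n * (3 / 2 * memoryError M (X w) + 3 * newMeanSqErr M (X w) (J w)) ∂P
      = ω / n * (3 / 2 * ∫ w, memoryError M (X w) ∂P + 3 * ∫ w, meanSqErr M (X' w) ∂P) := by
    simp_rw [← he_eq]
    rw [integral_const_mul, integral_add (hX.integrable_memory.const_mul _) (he.const_mul _),
      integral_const_mul, integral_const_mul]
  have hbar2 : Integrable (fun w => newSqMeanErr M (X w) (J w)) P := by
    simpa only [← hbar_eq] using hbar
  have hbar2_eq : ∫ w, newSqMeanErr M (X w) (J w) ∂P = ∫ w, sqMeanErr M (X' w) ∂P := by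
    simp_rw [hbar_eq]
  have he2 : Integrable (fun w => newMeanSqErr M (X w) (J w)) P := by
    simpa only [← he_eq] using he
  have hφp : Integrable (fun w => 4 / 3 * ‖M.h (X w).S‖ ^ 2 + 4 * newSqMeanErr M (X w) (J w)) P :=
    (hh.const_mul _).add (hbar2.const_mul _)
  obtain ⟨hp, hple⟩ := integrable_and_integral_le_of_indepFun hXJm hu hXJu hulaw
    (f := fun z => sqIncr (VRFedEM.step M quant α γ z.1.2 z.2 z.1.1))
    (measurable_sqIncr.comp hstepm) (fun z => sq_nonneg _)
    (φ := fun z => γ ^ 2 * (4 / 3 * ‖M.h z.1.S‖ ^ 2 + 4 * newSqMeanErr M z.1 z.2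
        + ω / n * (3 / 2 * memoryError M z.1 + 3 * newMeanSqErr M z.1 z.2)))
    ((hφp.add hVar).const_mul _)
    (fun w => integrable_sqIncr_step hQuant γ (X w) (J w))
    (fun w => integral_sqIncr_step_le hQuant γ (X w) (hV w) (J w))
  simp only [← hX'] at hp hple
  rw [integral_const_mul, integral_add hφp hVar, integral_add (hh.const_mul _)
    (hbar2.const_mul _), integral_const_mul, integral_const_mul, hVar_eq, hbar2_eq] at hple
  have hQm : ∀ i, Measurable fun z : (State q n × (Fin n → Fin b → Fin m)) × (Fin n → U) =>
      z.1.1.V i + α • quant (delta M z.1.1 i (z.1.2 i)) (z.2 i) - M.hLocal i z.1.1.S := by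
    intro i
    have h1 : Measurable fun z : (State q n × (Fin n → Fin b → Fin m)) × (Fin n → U) =>
        (VRFedEM.step M quant α γ z.1.2 z.2 z.1.1).V i :=
      ((measurable_pi_apply i).comp State.measurable_V).comp hstepm
    have h2 : Measurable fun z : (State q n × (Fin n → Fin b → Fin m)) × (Fin n → U) =>
        M.hLocal i z.1.1.S := (hLip.continuous_hLocal i).measurable.comp (by fun_prop)
    exact h1.sub h2
  obtain ⟨ha, hale⟩ := integrable_and_integral_le_of_indepFun hXJm hu hXJu hulaw
    (f := fun z => (n : ℝ)⁻¹ * ∑ i,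
      ‖z.1.1.V i + α • quant (delta M z.1.1 i (z.1.2 i)) (z.2 i) - M.hLocal i z.1.1.S‖ ^ 2)
    ((Finset.measurable_sum Finset.univ fun i _ => (hQm i).norm.pow_const 2).const_mul (n : ℝ)⁻¹)
    (fun z => mul_nonneg (inv_nonneg.2 (Nat.cast_nonneg n))
      (Finset.sum_nonneg fun i _ => sq_nonneg _))
    (φ := fun z => (1 - α) * memoryError M z.1 + α * newMeanSqErr M z.1 z.2)
    ((hX.integrable_memory.const_mul _).add (he2.const_mul _))
    (fun w => integrable_memory_update hQuant (X w) (J w))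
    (fun w => integral_memory_update_le hQuant hα (X w) (J w))
  rw [integral_add (hX.integrable_memory.const_mul _) (he2.const_mul _)] at hale
  simp only [integral_const_mul] at hale
  simp_rw [← he_eq] at hale
  have hc : 0 ≤ vmin / (2 * γ) - LW / 2 := by
    rw [sub_nonneg, div_le_div_iff₀ two_pos (by positivity)]
    linarith
  have hexcm : Measurable (excess M : State q n → ℝ) :=
    (hLyap.contDiff.continuous.measurable.comp State.measurable_S).sub_const _
  have hφW1 : Integrable (fun w => excess M (X w) - γ * vmin / 2 * ‖M.h (X w).S‖ ^ 2) P :=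
    hX.integrable_excess.sub (hh.const_mul _)
  have hφW2 : Integrable (fun w => excess M (X w) - γ * vmin / 2 * ‖M.h (X w).S‖ ^ 2
      + γ * vmax / 2 * newSqMeanErr M (X w) (J w)) P := hφW1.add (hbar2.const_mul _)
  obtain ⟨hW, hWle⟩ := integrable_and_integral_le_of_indepFun hXJm hu hXJu hulaw
    (f := fun z => excess M (VRFedEM.step M quant α γ z.1.2 z.2 z.1.1)
      + (vmin / (2 * γ) - LW / 2) * sqIncr (VRFedEM.step M quant α γ z.1.2 z.2 z.1.1))
    ((hexcm.comp hstepm).add ((measurable_sqIncr.comp hstepm).const_mul _))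
    (fun z => add_nonneg (excess_nonneg hBdd _) (mul_nonneg hc (sq_nonneg _)))
    (φ := fun z => excess M z.1 - γ * vmin / 2 * ‖M.h z.1.S‖ ^ 2
      + γ * vmax / 2 * newSqMeanErr M z.1 z.2
      + γ * vmin / 2 * (ω / n * (3 / 2 * memoryError M z.1 + 3 * newMeanSqErr M z.1 z.2)))
    (hφW2.add (hVar.const_mul _))
    (fun w => (integrable_W_step hQuant hLyap hBdd (X w) (J w)).add
      ((integrable_sqIncr_step hQuant γ (X w) (J w)).const_mul _))
    (fun w => integral_W_step_le hQuant hLyap hBdd hγ (X w) (hV w) (J w))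
  simp only [← hX'] at hW hWle
  have hexc : Integrable (fun w => excess M (X' w)) P := by
    refine (hW.sub (hp.const_mul (vmin / (2 * γ) - LW / 2))).congr (ae_of_all _ fun w => ?_)
    simp
  rw [integral_add hexc (hp.const_mul _), integral_const_mul, integral_add hφW2
    (hVar.const_mul _), integral_const_mul, hVar_eq, integral_add hφW1 (hbar2.const_mul _),
    integral_sub hX.integrable_excess (hh.const_mul _), integral_const_mul, integral_const_mul,
    hbar2_eq] at hWle
  have hgle : ∀ w, memoryError M (X' w) ≤ (1 + α / 3) * ((n : ℝ)⁻¹ *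
      ∑ i, ‖(X w).V i + α • quant (delta M (X w) i (J w i)) (u w i) - M.hLocal i (X w).S‖ ^ 2)
      + (1 + 3 / α) * meanLip Lip ^ 2 * sqIncr (X' w) := fun w => by
    rw [hX' w]
    exact memoryError_step_le hm hLip hα0 γ (X w) (J w) (u w)
  have hgint := (ha.const_mul (1 + α / 3)).add (hp.const_mul ((1 + 3 / α) * meanLip Lip ^ 2))
  have hg : Integrable (fun w => memoryError M (X' w)) P := by
    refine hgint.mono' ((measurable_memoryError hLip).comp hX'm).aestronglyMeasurable
      (ae_of_all _ fun w => ?_)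
    rw [Real.norm_of_nonneg (memoryError_nonneg _)]
    exact hgle w
  refine ⟨⟨hX'm, hg, hexc, he, hbar, hp⟩, hele, hbarle, hple, ?_, hWle⟩
  have h1 := integral_mono hg hgint hgle
  rw [integral_add' (ha.const_mul _) (hp.const_mul _)] at h1
  simp only [integral_const_mul] at h1
  have h2 := mul_le_mul_of_nonneg_left hale (by positivity : 0 ≤ 1 + α / 3)
  linarith

end Expectation

/-! ### The step size and the summed recursions -/

/-- The defining properties of the step size, in terms of the gap `X = 1 - γ LW / vmin`. -/
theorem stepSize_spec {n : ℕ} (hn : 0 < n) {LW vmin vmax L ω : ℝ} (hLW : 0 < LW)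
    (hvmin : 0 < vmin) (hv : vmin ≤ vmax) (hL : 0 ≤ L) (hω : 0 ≤ ω) {γ : ℝ}
    (hγ : γ = stepSize n LW vmin vmax L ω) :
    0 < γ ∧ γ * LW ≤ vmin ∧
      4 * (1 + 18 * ω) * (vmax / vmin) ^ 2 * (L ^ 2 * γ ^ 2 * (1 + ω) ^ 2 / n) =
        (1 - γ * LW / vmin) ^ 2 := by
  have hn0 : (0 : ℝ) < n := Nat.cast_pos.2 hn
  set x : ℝ := 4 * Real.sqrt 2 * (vmax / LW) * (L / Real.sqrt n) * (1 + ω) *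
    Real.sqrt (ω + (1 + 10 * ω) / 8) with hx
  have hvmax : 0 < vmax := hvmin.trans_le hv
  have hx0 : 0 ≤ x := by positivity
  have hγ' : γ = vmin / LW * (1 + x)⁻¹ := hγ
  have h1x : 0 < 1 + x := by linarith
  have hγLW : γ * LW / vmin = (1 + x)⁻¹ := by
    rw [hγ']
    field_simp
  have hγ0 : 0 < γ := by
    rw [hγ']
    positivity
  have hx2 : x ^ 2 = 4 * (1 + 18 * ω) * (vmax / LW) ^ 2 * (L ^ 2 * (1 + ω) ^ 2 / n) := by
    rw [hx]
    simp only [mul_pow, div_pow]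
    rw [Real.sq_sqrt two_pos.le, Real.sq_sqrt hn0.le, Real.sq_sqrt (by positivity)]
    field_simp
    ring
  refine ⟨hγ0, ?_, ?_⟩
  · have : (1 + x)⁻¹ ≤ 1 := inv_le_one_of_one_le₀ (by linarith)
    rw [← hγLW, div_le_one hvmin] at this
    exact this
  · have h1 : 1 - (1 + x)⁻¹ = x * (1 + x)⁻¹ := by
      field_simp
      ring
    rw [hγLW, h1, mul_pow, hx2, ← hγLW]
    field_simp

/-- Summation of the memory recursion `g⁺ ≤ (1 - c) g + R` with `c = α (2 + α) / 3`; both the sum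
of the `g` and the sum of the `g⁺` are bounded. -/
theorem sum_memory_le {α Gs Gs1 g0 Q Es B : ℝ} (hα : 0 < α) (hα1 : α ≤ 1) (hg0 : 0 ≤ g0)
    (hQ : 0 ≤ Q) (hEs : Es ≤ Q) (hB : B = α ^ 2 * Q)
    (hrec : Gs1 ≤ (1 + α / 3) * ((1 - α) * Gs + α * Es) + (1 + 3 / α) * B)
    (hend : 0 ≤ Gs1 - Gs + g0) :
    Gs ≤ 3 / 2 * α⁻¹ * g0 + 6 * Q ∧ Gs1 ≤ 3 / 2 * α⁻¹ * g0 + 6 * Q := by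
  -- `(1 + α / 3) (1 - α) = 1 - c`
  set c := α * (2 + α) / 3 with hc
  have hc0 : 0 < c := by positivity
  have hc1 : c ≤ 1 := by
    rw [hc]
    nlinarith
  have hB' : (1 + 3 / α) * B = (α ^ 2 + 3 * α) * Q := by
    rw [hB]
    field_simp
  have hEs' : (1 + α / 3) * α * Es ≤ (1 + α / 3) * α * Q :=
    mul_le_mul_of_nonneg_left hEs (by positivity)
  have hR : Gs1 ≤ (1 - c) * Gs + 6 * c * Q := by
    have h1 : (1 + α / 3) * α * Q + (α ^ 2 + 3 * α) * Q ≤ 6 * c * Q := by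
      rw [hc]
      nlinarith [mul_nonneg (sq_nonneg α) hQ]
    have h2 : (1 + α / 3) * ((1 - α) * Gs + α * Es) = (1 - c) * Gs + (1 + α / 3) * α * Es := by
      rw [hc]
      ring
    linarith
  have hg : g0 ≤ c * (3 / 2 * α⁻¹ * g0) := by
    have : c * (3 / 2 * α⁻¹ * g0) = (1 + α / 2) * g0 := by
      rw [hc]
      field_simp
    rw [this]
    nlinarith
  have hGs : c * Gs ≤ c * (3 / 2 * α⁻¹ * g0 + 6 * Q) := by linarith
  have hGs' := le_of_mul_le_mul_left hGs hc0
  refine ⟨hGs', ?_⟩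
  have := mul_le_mul_of_nonneg_left hGs' (sub_nonneg.2 hc1)
  linarith

/-- The quantities `A`, `D`, `H` are the summed squared fields `E‖H_{t,k+1}‖²`, the initial excess
divided by `γ vmin`, and the summed squared mean fields. The second hypothesis bounds `A` by the
mean fields, the third one is the summed decrease of `W`. -/
theorem sum_field_le {A D H Γ u ω r X : ℝ} (hA : 0 ≤ A) (hu : 0 ≤ u) (hω : 0 ≤ ω)
    (hr : 1 ≤ r) (hX0 : 0 ≤ X) (hX1 : X ≤ 1) (hX : 4 * (1 + 18 * ω) * r ^ 2 * u = X ^ 2)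
    (h1 : A ≤ 4 / 3 * H + 4 * (u * A) + (Γ + 12 * ω * (u * A)))
    (h2 : X * A ≤ 2 * D - H + r * (u * A) + (Γ + 12 * ω * (u * A))) :
    A ≤ 8 / 3 * D + 7 / 3 * Γ := by
  have hr2 : r ≤ r ^ 2 := by nlinarith
  have hr1 : 1 ≤ r ^ 2 := hr.trans hr2
  have hωr : ω ≤ ω * r ^ 2 := le_mul_of_one_le_right hω hr1
  have hωr0 : 0 ≤ ω * r ^ 2 := hω.trans hωr
  have k1 : u * (r + 12 * ω) ≤ X ^ 2 / 4 := by
    have : u * (r + 12 * ω) ≤ u * ((1 + 18 * ω) * r ^ 2) :=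
      mul_le_mul_of_nonneg_left (by nlinarith) hu
    linarith
  have k2 : u * (4 + 12 * ω) ≤ X ^ 2 := by
    have : u * (4 + 12 * ω) ≤ u * (4 * (1 + 18 * ω) * r ^ 2) :=
      mul_le_mul_of_nonneg_left (by nlinarith) hu
    linarith
  have k1' := mul_le_mul_of_nonneg_right k1 hA
  have k2' := mul_le_mul_of_nonneg_right k2 hA
  -- The coefficient `1 + (4 / 3) X (1 - X)` of `A` obtained by eliminating `H` is at least one.
  have h3 : 0 ≤ X * (1 - X) * A := mul_nonneg (mul_nonneg hX0 (sub_nonneg.2 hX1)) hA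
  nlinarith

/-- The summed recursions imply the bound on the summed memory errors. -/
theorem sum_memory_le_of_recursions {n : ℕ} (hn : 0 < n) {LW vmin vmax L ω α γ : ℝ} (hLW : 0 < LW)
    (hvmin : 0 < vmin) (hv : vmin ≤ vmax) (hL : 0 ≤ L) (hω : 0 ≤ ω)
    (hα : α = 1 / (1 + ω)) (hγ : γ = stepSize n LW vmin vmax L ω)
    {Gs Gs1 g0 w0 Es Ebs Ps Hs : ℝ} (hg0 : 0 ≤ g0) (hPs : 0 ≤ Ps)
    (hEs : Es ≤ (1 + ω) ^ 2 * L ^ 2 * Ps) (hEbs : Ebs ≤ (1 + ω) ^ 2 * L ^ 2 * Ps / n)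
    (hrecP : Ps ≤ γ ^ 2 * (4 / 3 * Hs + 4 * Ebs + ω / n * (3 / 2 * Gs + 3 * Es)))
    (hrecG : Gs1 ≤ (1 + α / 3) * ((1 - α) * Gs + α * Es) + (1 + 3 / α) * L ^ 2 * Ps)
    (hend : 0 ≤ Gs1 - Gs + g0)
    (hrecW : (vmin / (2 * γ) - LW / 2) * Ps ≤ w0 - γ * vmin / 2 * Hs + γ * vmax / 2 * Ebs
      + γ * vmin / 2 * (ω / n * (3 / 2 * Gs + 3 * Es))) :
    Gs1 ≤ 2 * (1 + ω) * g0 + 16 * γ * ((1 + ω) ^ 2 * L ^ 2 / vmin) * w0 := by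
  obtain ⟨hγ0, hγLW, hspec⟩ := stepSize_spec hn hLW hvmin hv hL hω hγ
  have hn0 : (0 : ℝ) < n := Nat.cast_pos.2 hn
  have hs : 0 < 1 + ω := by linarith
  have hvmax : 0 < vmax := hvmin.trans_le hv
  have hα0 : 0 < α := hα ▸ one_div_pos.2 hs
  have hα1 : α ≤ 1 := by
    rw [hα, div_le_one hs]
    linarith
  have hαinv : α⁻¹ = 1 + ω := by rw [hα, one_div, inv_inv]
  set Q := (1 + ω) ^ 2 * L ^ 2 * Ps with hQdef
  have hQ : 0 ≤ Q := by positivity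
  have hB : L ^ 2 * Ps = α ^ 2 * Q := by
    rw [hQdef, hα]
    field_simp
  rw [mul_assoc (1 + 3 / α)] at hrecG
  obtain ⟨hGs, hGs1⟩ := sum_memory_le hα0 hα1 hg0 hQ hEs hB hrecG hend
  rw [hαinv] at hGs hGs1
  set u := L ^ 2 * γ ^ 2 * (1 + ω) ^ 2 / n with hu
  set A := Ps / γ ^ 2 with hA
  have hPsA : Ps = γ ^ 2 * A := by
    rw [hA]
    field_simp
  have hQA : Q = n * (u * A) := by
    rw [hQdef, hu, hPsA]
    field_simp
  have hA0 : 0 ≤ A := by positivity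
  have hu0 : 0 ≤ u := by positivity
  set Γ := 9 / 4 * ω * (1 + ω) * g0 / n with hΓ
  have hV : ω / n * (3 / 2 * Gs + 3 * Es) ≤ Γ + 12 * ω * (u * A) := by
    have h1 : 3 / 2 * Gs + 3 * Es ≤ 9 / 4 * (1 + ω) * g0 + 12 * Q := by linarith
    refine (mul_le_mul_of_nonneg_left h1 (by positivity)).trans (le_of_eq ?_)
    rw [hΓ, hQA]
    field_simp
  have hEb : Ebs ≤ u * A := by
    refine hEbs.trans (le_of_eq ?_)
    rw [hQA]
    field_simp
  have hX0 : 0 ≤ 1 - γ * LW / vmin := by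
    rw [sub_nonneg, div_le_one hvmin]
    exact hγLW
  have hX1 : 1 - γ * LW / vmin ≤ 1 := by
    have : 0 ≤ γ * LW / vmin := by positivity
    linarith
  have h1 : A ≤ 4 / 3 * Hs + 4 * (u * A) + (Γ + 12 * ω * (u * A)) := by
    rw [hPsA] at hrecP
    have := le_of_mul_le_mul_left hrecP (pow_pos hγ0 2)
    linarith
  have h2 : (1 - γ * LW / vmin) * A ≤ 2 * (w0 / (γ * vmin)) - Hs + vmax / vmin * (u * A)
      + (Γ + 12 * ω * (u * A)) := by
    have e1 : (vmin / (2 * γ) - LW / 2) * Ps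
        = γ * vmin / 2 * ((1 - γ * LW / vmin) * A) := by
      rw [hPsA]
      field_simp
    have e2 : w0 - γ * vmin / 2 * Hs + γ * vmax / 2 * Ebs
        + γ * vmin / 2 * (ω / n * (3 / 2 * Gs + 3 * Es))
        = γ * vmin / 2 * (2 * (w0 / (γ * vmin)) - Hs + vmax / vmin * Ebs
          + ω / n * (3 / 2 * Gs + 3 * Es)) := by
      field_simp
    rw [e1, e2] at hrecW
    have h3 := le_of_mul_le_mul_left hrecW (by positivity)
    have h4 := mul_le_mul_of_nonneg_left hEb (by positivity : 0 ≤ vmax / vmin)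
    linarith
  have hfield := sum_field_le hA0 hu0 hω ((one_le_div hvmin).2 hv) hX0 hX1 hspec h1 h2
  have h5 := mul_le_mul_of_nonneg_left hfield (by positivity : 0 ≤ 6 * (n * u))
  have e3 : 6 * (n * u) * (8 / 3 * (w0 / (γ * vmin)) + 7 / 3 * Γ)
      = 16 * γ * ((1 + ω) ^ 2 * L ^ 2 / vmin) * w0 + 63 / 2 * (u * ω) * ((1 + ω) * g0) := by
    rw [hΓ, hu]
    field_simp
    ring
  have huω : 72 * (u * ω) ≤ 1 := by
    have k1 : 1 ≤ (vmax / vmin) ^ 2 := one_le_pow₀ ((one_le_div hvmin).2 hv)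
    have k2 : 4 * (1 + 18 * ω) * u ≤ 4 * (1 + 18 * ω) * u * (vmax / vmin) ^ 2 :=
      le_mul_of_one_le_right (by positivity) k1
    have k3 : (1 - γ * LW / vmin) ^ 2 ≤ 1 := pow_le_one₀ hX0 hX1
    rw [mul_right_comm (4 * (1 + 18 * ω)), hspec] at k2
    linarith only [k2, k3, hu0]
  have h6 := mul_le_mul_of_nonneg_right huω (by positivity : 0 ≤ (1 + ω) * g0)
  have h7 : 0 ≤ (1 + ω) * g0 := by positivity
  rw [hQA] at hGs1
  rw [e3] at h5
  linarith only [hGs1, h5, h6, h7]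

/-- An error accumulating the increments `p` since the last restart. -/
theorem sum_error_le {K : ℕ} {c : ℝ} (hc : 0 ≤ c) {e p : ℕ → ℝ} (hp : ∀ k, 0 ≤ p k)
    (he0 : e 0 = 0) (hp0 : p 0 = 0) (hrec : ∀ k < K, e (k + 1) ≤ e k + c * p k) :
    ∑ k ∈ Finset.range K, e (k + 1) ≤ K * c * ∑ k ∈ Finset.range K, p (k + 1) := by
  have h : ∀ k ≤ K, e k ≤ c * ∑ l ∈ Finset.range k, p l := by
    intro k hk
    induction k with
    | zero => simp [he0]
    | succ k ih =>
      rw [Finset.sum_range_succ, mul_add]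
      exact (hrec k hk).trans (add_le_add_left (ih (by omega)) _)
  have h2 : ∀ k ∈ Finset.range K, e (k + 1) ≤ c * ∑ l ∈ Finset.range K, p (l + 1) := by
    intro k hk
    rw [Finset.mem_range] at hk
    refine (h (k + 1) hk).trans (mul_le_mul_of_nonneg_left ?_ hc)
    rw [Finset.sum_range_succ', hp0, add_zero]
    exact Finset.sum_le_sum_of_subset_of_nonneg (Finset.range_mono hk.le) fun l _ _ => hp _
  refine (Finset.sum_le_sum h2).trans (le_of_eq ?_)
  simp [mul_assoc]

theorem sum_sum_sub_eq {kout kin : ℕ} {f : ℕ → ℕ → ℝ} (hf : ∀ t, f (t + 1) 0 = f t kin) :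
    ∑ t ∈ Finset.range kout, ∑ k ∈ Finset.range kin, f t (k + 1)
      - ∑ t ∈ Finset.range kout, ∑ k ∈ Finset.range kin, f t k = f kout 0 - f 0 0 := by
  rw [← Finset.sum_sub_distrib, ← Finset.sum_range_sub (fun t => f t 0) kout]
  refine Finset.sum_congr rfl fun t _ => ?_
  rw [← Finset.sum_sub_distrib, Finset.sum_range_sub (f t) kin, hf]

/-! ### Independence of the past and the fresh randomness -/

section Independence

variable {q n m b : ℕ} {U Ω : Type*} [MeasurableSpace U] 
  {kout kin : ℕ}
  {S₀ : Ω → Vec q} {V₀ : Ω → Fin n → Vec q}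
  {J : ℕ → ℕ → Fin n → Ω → Fin b → Fin m} {u : ℕ → ℕ → Fin n → Ω → U}

theorem measurable_of_source_mem {A : Set (Source kout kin n)} {x : Source kout kin n}
    (hx : x ∈ A) {E : Type*} {mE : MeasurableSpace E} {f : Ω → E}
    (hf : Measurable[sourceSigma kout kin S₀ V₀ J u x] f) :
    Measurable[⨆ x ∈ A, sourceSigma kout kin S₀ V₀ J u x] f :=
  hf.mono (le_iSup₂_of_le x hx le_rfl) le_rfl

theorem measurable_pi_of_source_mem {A : Set (Source kout kin n)} {ι E : Type*}
    [MeasurableSpace E] {x : ι → Source kout kin n} (hx : ∀ i, x i ∈ A) {f : ι → Ω → E}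
    (hf : ∀ i, Measurable[sourceSigma kout kin S₀ V₀ J u (x i)] (f i)) :
    Measurable[⨆ x ∈ A, sourceSigma kout kin S₀ V₀ J u x] fun w i => f i w :=
  @measurable_pi_lambda _ _ _ (⨆ x ∈ A, sourceSigma kout kin S₀ V₀ J u x) _ _ fun i =>
    measurable_of_source_mem (hx i) (hf i)

/-- The sources of randomness revealed before time `(t, k)`. -/
def Source.Before (t k : ℕ) : Source kout kin n → Prop
  | .init => True
  | .batch t' k' _ => t'.1 < t ∨ (t'.1 = t ∧ k'.1 < k)
  | .noise t' k' _ => t'.1 < t ∨ (t'.1 = t ∧ k'.1 < k)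

variable {d : ℕ} {Y Z : Type*} [MeasurableSpace Z] {M : EMModel d q n m Y Z}
  {Lip : Fin n → Fin m → ℝ} {quant : Vec q → U → Vec q} {α γ : ℝ}

/-- The state at time `(t, k)` depends only on the sources revealed before. -/
theorem measurable_run_before (hLip : M.IsLipschitzField Lip)
    (hquant : Measurable (Function.uncurry quant)) {t k : ℕ} (ht : t < kout) (hk : k ≤ kin)
    {A : Set (Source kout kin n)} (hA : ∀ x : Source kout kin n, x.Before t k → x ∈ A) :
    Measurable[⨆ x ∈ A, sourceSigma kout kin S₀ V₀ J u x]
      fun w => run M quant α (fun _ _ => γ) kin (fun t k i => J t k i w) (fun t k i => u t k i w)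
        (S₀ w) (V₀ w) t k := by
  have hinit : Measurable[⨆ x ∈ A, sourceSigma kout kin S₀ V₀ J u x] fun w => (S₀ w, V₀ w) :=
    measurable_of_source_mem (hA .init trivial) (comap_measurable _)
  refine @measurable_run d q n m b Y Z U _ M Ω (⨆ x ∈ A, sourceSigma kout kin S₀ V₀ J u x) Lip _
    quant α hLip hquant _ kin S₀ (measurable_fst.comp hinit) V₀ (measurable_snd.comp hinit)
    J u t k ?_ ?_
  · intro t' k' h i
    have h1 : t' < kout := by omega
    have h2 : k' < kin := by omega
    have h3 : (Source.batch (n := n) (⟨t', h1⟩ : Fin kout) (⟨k', h2⟩ : Fin kin) i).Before t k := by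
      simp only [Source.Before]
      omega
    exact measurable_of_source_mem (hA _ h3) (comap_measurable _)
  · intro t' k' h i
    have h1 : t' < kout := by omega
    have h2 : k' < kin := by omega
    have h3 : (Source.noise (n := n) (⟨t', h1⟩ : Fin kout) (⟨k', h2⟩ : Fin kin) i).Before t k := by
      simp only [Source.Before]
      omega
    exact measurable_of_source_mem (hA _ h3) (comap_measurable _)

variable [mΩ : MeasurableSpace Ω] {P : Measure Ω} {ν : Measure U} {sch : Sampling}

theorem IsRandomness.sourceSigma_le (hR : IsRandomness P ν sch kout kin S₀ V₀ J u)
    (x : Source kout kin n) : sourceSigma kout kin S₀ V₀ J u x ≤ mΩ := by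
  cases x with
  | init => exact (hR.measurable_S₀.prodMk hR.measurable_V₀).comap_le
  | batch t k i => exact (hR.measurable_batch t t.2 k k.2 i).comap_le
  | noise t k i => exact (hR.measurable_noise t t.2 k k.2 i).comap_le

theorem IsRandomness.indepFun_of_disjoint (hR : IsRandomness P ν sch kout kin S₀ V₀ J u)
    {A B : Set (Source kout kin n)} (hAB : Disjoint A B) {E F : Type*} [MeasurableSpace E]
    [MeasurableSpace F] {f : Ω → E} {g : Ω → F}
    (hf : Measurable[⨆ x ∈ A, sourceSigma kout kin S₀ V₀ J u x] f)
    (hg : Measurable[⨆ x ∈ B, sourceSigma kout kin S₀ V₀ J u x] g) : IndepFun f g P :=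
  indep_of_indep_of_le_left (indep_of_indep_of_le_right
    (indep_iSup_of_disjoint hR.sourceSigma_le hR.indep hAB) hg.comap_le) hf.comap_le

theorem IsRandomness.map_batch [IsProbabilityMeasure P]
    (hR : IsRandomness P ν sch kout kin S₀ V₀ J u) {t k : ℕ} (ht : t < kout) (hk : k < kin) :
    P.map (fun w i => J t k i w) = Measure.pi fun _ => uniformOn (sch.outcomes b m) := by
  have hI : iIndepFun (fun i => J t k i) P :=
    hR.indep.precomp (g := fun i => Source.batch ⟨t, ht⟩ ⟨k, hk⟩ i) fun i j h => by
      injection h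
  rw [(iIndepFun_iff_map_fun_eq_pi_map
    fun i => (hR.measurable_batch t ht k hk i).aemeasurable).1 hI]
  simp_rw [hR.law_batch t ht k hk]

theorem IsRandomness.map_noise [IsProbabilityMeasure P]
    (hR : IsRandomness P ν sch kout kin S₀ V₀ J u) {t k : ℕ} (ht : t < kout) (hk : k < kin) :
    P.map (fun w i => u t k i w) = Measure.pi fun _ => ν := by
  have hI : iIndepFun (fun i => u t k i) P :=
    hR.indep.precomp (g := fun i => Source.noise ⟨t, ht⟩ ⟨k, hk⟩ i) fun i j h => by
      injection h
  rw [(iIndepFun_iff_map_fun_eq_pi_map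
    fun i => (hR.measurable_noise t ht k hk i).aemeasurable).1 hI]
  simp_rw [hR.law_noise t ht k hk]

theorem IsRandomness.indepFun_run_batch (hR : IsRandomness P ν sch kout kin S₀ V₀ J u)
    (hLip : M.IsLipschitzField Lip) (hquant : Measurable (Function.uncurry quant)) {t k : ℕ}
    (ht : t < kout) (hk : k < kin) :
    IndepFun (fun w => run M quant α (fun _ _ => γ) kin (fun t k i => J t k i w)
      (fun t k i => u t k i w) (S₀ w) (V₀ w) t k) (fun w i => J t k i w) P := by
  refine hR.indepFun_of_disjoint (A := {x | x.Before t k})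
    (B := Set.range fun i => Source.batch ⟨t, ht⟩ ⟨k, hk⟩ i) ?_
    (measurable_run_before hLip hquant ht hk.le fun x hx => hx)
    (measurable_pi_of_source_mem (x := fun i => Source.batch ⟨t, ht⟩ ⟨k, hk⟩ i)
      (fun i => Set.mem_range_self i) fun i => comap_measurable _)
  rw [Set.disjoint_left]
  rintro x hx ⟨i, rfl⟩
  simp [Source.Before] at hx

theorem IsRandomness.indepFun_run_batch_noise (hR : IsRandomness P ν sch kout kin S₀ V₀ J u)
    (hLip : M.IsLipschitzField Lip) (hquant : Measurable (Function.uncurry quant)) {t k : ℕ}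
    (ht : t < kout) (hk : k < kin) :
    IndepFun (fun w => (run M quant α (fun _ _ => γ) kin (fun t k i => J t k i w)
      (fun t k i => u t k i w) (S₀ w) (V₀ w) t k, fun i => J t k i w))
      (fun w i => u t k i w) P := by
  refine hR.indepFun_of_disjoint
    (A := {x | x.Before t k} ∪ Set.range fun i => Source.batch ⟨t, ht⟩ ⟨k, hk⟩ i)
    (B := Set.range fun i => Source.noise ⟨t, ht⟩ ⟨k, hk⟩ i) ?_
    (@Measurable.prodMk _ _ _ _ _ (_) _ _
      (measurable_run_before hLip hquant ht hk.le fun x hx => Or.inl hx)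
      (measurable_pi_of_source_mem (x := fun i => Source.batch ⟨t, ht⟩ ⟨k, hk⟩ i)
        (fun i => Or.inr (Set.mem_range_self i)) fun i => comap_measurable _))
    (measurable_pi_of_source_mem (x := fun i => Source.noise ⟨t, ht⟩ ⟨k, hk⟩ i)
      (fun i => Set.mem_range_self i) fun i => comap_measurable _)
  rw [Set.disjoint_left]
  rintro x hx ⟨i, rfl⟩
  simp [Source.Before] at hx

end Independence

/-! ### The trajectory -/

section Trajectory

variable {d q n m b : ℕ} {Y Z U : Type*} [MeasurableSpace Z] {M : EMModel d q n m Y Z}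
  {quant : Vec q → U → Vec q} {α : ℝ}

/-- The server memory is always the mean of the local memories. -/
theorem innerLoop_Vbar (γ : ℕ → ℝ) (J : ℕ → Fin n → Fin b → Fin m) (u : ℕ → Fin n → U)
    {st : State q n} (hst : st.Vbar = (n : ℝ)⁻¹ • ∑ i, st.V i) (k : ℕ) :
    (innerLoop M quant α γ J u st k).Vbar =
      (n : ℝ)⁻¹ • ∑ i, (innerLoop M quant α γ J u st k).V i := by
  induction k with
  | zero => exact hst
  | succ k ih =>
    simp only [innerLoop, step, ih, Finset.sum_add_distrib, ← Finset.smul_sum, smul_add, smul_smul]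
    rw [mul_comm α]

theorem run_Vbar (γ : ℕ → ℕ → ℝ) (kin : ℕ) (J : ℕ → ℕ → Fin n → Fin b → Fin m)
    (u : ℕ → ℕ → Fin n → U) (S₀ : Vec q) (V₀ : Fin n → Vec q) (t k : ℕ) :
    (run M quant α γ kin J u S₀ V₀ t k).Vbar =
      (n : ℝ)⁻¹ • ∑ i, (run M quant α γ kin J u S₀ V₀ t k).V i := by
  refine innerLoop_Vbar _ _ _ ?_ k
  induction t with
  | zero => rfl
  | succ t ih => exact innerLoop_Vbar (γ t) (J t) (u t) ih kin

theorem meanSqErr_run_zero (γ : ℕ → ℕ → ℝ) (kin : ℕ) (J : ℕ → ℕ → Fin n → Fin b → Fin m)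
    (u : ℕ → ℕ → Fin n → U) (S₀ : Vec q) (V₀ : Fin n → Vec q) (t : ℕ) :
    meanSqErr M (run M quant α γ kin J u S₀ V₀ t 0) = 0 := by
  cases t <;> simp [run, innerLoop, outerLoop, initState, restart, meanSqErr]

theorem sqMeanErr_run_zero (γ : ℕ → ℕ → ℝ) (kin : ℕ) (J : ℕ → ℕ → Fin n → Fin b → Fin m)
    (u : ℕ → ℕ → Fin n → U) (S₀ : Vec q) (V₀ : Fin n → Vec q) (t : ℕ) :
    sqMeanErr M (run M quant α γ kin J u S₀ V₀ t 0) = 0 := by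
  cases t <;> simp [run, innerLoop, outerLoop, initState, restart, sqMeanErr]

theorem sqIncr_run_zero (γ : ℕ → ℕ → ℝ) (kin : ℕ) (J : ℕ → ℕ → Fin n → Fin b → Fin m)
    (u : ℕ → ℕ → Fin n → U) (S₀ : Vec q) (V₀ : Fin n → Vec q) (t : ℕ) :
    sqIncr (run M quant α γ kin J u S₀ V₀ t 0) = 0 := by
  cases t <;> simp [run, innerLoop, outerLoop, initState, restart, sqIncr]

end Trajectory

theorem sum_Icc_one_eq_sum_range (f : ℕ → ℝ) (K : ℕ) :
    ∑ k ∈ Finset.Icc 1 K, f k = ∑ k ∈ Finset.range K, f (k + 1) := by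
  rw [Finset.range_eq_Ico, Finset.sum_Ico_add' f 0 K 1]
  rfl

/-! ### The bound on the memory errors -/

section Main

variable {d q n m b : ℕ} {Y Z U Ω : Type*} [MeasurableSpace Z] [MeasurableSpace U]
  [MeasurableSpace Ω] {M : EMModel d q n m Y Z} {P : Measure Ω}

/-- A restart changes neither the memory error nor the excess, and cancels the other errors. -/
theorem HasMoments.restart {Lip : Fin n → Fin m → ℝ} (hLip : M.IsLipschitzField Lip)
    {X : Ω → State q n} (hX : HasMoments M P X) : HasMoments M P fun w => restart M (X w) where
  measurable := by
    have hS := State.measurable_S.comp hX.measurable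
    have hV := State.measurable_V.comp hX.measurable
    have hVbar := State.measurable_Vbar.comp hX.measurable
    exact State.measurable_of_components hS hS (measurable_pi_lambda _ fun i =>
      (hLip.continuous_sbarLocal i).measurable.comp hS) hV hVbar
  integrable_memory := hX.integrable_memory
  integrable_excess := hX.integrable_excess
  integrable_meanSqErr := by simp [meanSqErr, VRFedEM.restart]
  integrable_sqMeanErr := by simp [sqMeanErr, VRFedEM.restart]
  integrable_sqIncr := by simp [sqIncr, VRFedEM.restart]

end Main

end VRFedEM

end

open VRFedEM in
theorem mainTheorem5 {d q n m : ℕ} (hn : 0 < n) (hm : 0 < m)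
    {Y Z : Type*} [MeasurableSpace Z] (M : VRFedEM.EMModel d q n m Y Z)
    (hReg : M.IsRegular) (hCond : M.HasCondExpectations) (hArg : M.HasUniqueArgmin)
    {LW vmin vmax : ℝ} (hLyap : M.IsLyapunov LW vmin vmax)
    (hBdd : BddBelow (Set.range M.W))
    {Lip : Fin n → Fin m → ℝ} (hLip : M.IsLipschitzField Lip)
    {U : Type*} [MeasurableSpace U] (ν : Measure U) [IsProbabilityMeasure ν]
    (quant : VRFedEM.Vec q → U → VRFedEM.Vec q) {ω : ℝ} (hQuant : VRFedEM.IsQuantizer quant ν ω)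
    {kout kin b : ℕ} (hkout : 0 < kout) (hkin : 0 < kin)
    (hb : b = ⌈(kin : ℝ) / (1 + ω) ^ 2⌉₊) (sch : VRFedEM.Sampling)
    {Ω : Type*} [MeasurableSpace Ω] (P : Measure Ω) [IsProbabilityMeasure P]
    (S₀ : Ω → VRFedEM.Vec q) (V₀ : Ω → Fin n → VRFedEM.Vec q)
    (J : ℕ → ℕ → Fin n → Ω → Fin b → Fin m) (u : ℕ → ℕ → Fin n → Ω → U)
    (hRand : VRFedEM.IsRandomness P ν sch kout kin S₀ V₀ J u)
    (L γ α : ℝ) (hL : L = VRFedEM.meanLip Lip) (hα : α = 1 / (1 + ω))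
    (hγ : γ = VRFedEM.stepSize n LW vmin vmax L ω)
    (G : ℕ → ℕ → Ω → ℝ)
    (hG : ∀ t k w, G t k w = VRFedEM.memoryError M
      (VRFedEM.run M quant α (fun _ _ => γ) kin (fun t k i => J t k i w) (fun t k i => u t k i w)
        (S₀ w) (V₀ w) t k))
    (hW₀ : Integrable (fun w => M.W (S₀ w)) P) (hG₀ : Integrable (G 0 0) P) :
    (∀ t < kout, ∀ k ≤ kin, Integrable (G t k) P) ∧
      1 / ((kout : ℝ) * kin) * ∑ t ∈ Finset.range kout, ∑ k ∈ Finset.Icc 1 kin, ∫ w, G t k w ∂P ≤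
        2 * (1 + ω) / ((kin : ℝ) * kout) * ∫ w, G 0 0 w ∂P +
          16 * (γ / ((kin : ℝ) * kout)) * ((1 + ω) ^ 2 * L ^ 2 / vmin) *
            (∫ w, M.W (S₀ w) ∂P - ⨅ s, M.W s) := by
  have hω := hQuant.omega_nonneg
  have hs : 0 < 1 + ω := by linarith
  have hkin0 : (0 : ℝ) < kin := Nat.cast_pos.2 hkin
  have hkout0 : (0 : ℝ) < kout := Nat.cast_pos.2 hkout
  have hn0 : (0 : ℝ) < n := Nat.cast_pos.2 hn
  have hL0 : 0 ≤ L := hL ▸ Real.sqrt_nonneg _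
  obtain ⟨hγ0, hγLW, -⟩ := stepSize_spec hn hLyap.LW_pos hLyap.vmin_pos hLyap.vmin_le_vmax hL0 hω hγ
  have hb0 : 0 < b := by
    rw [hb, Nat.ceil_pos]
    positivity
  have hbr : (0 : ℝ) < b := Nat.cast_pos.2 hb0
  have hkb : (kin : ℝ) / b ≤ (1 + ω) ^ 2 := by
    rw [div_le_iff₀ hbr, mul_comm, ← div_le_iff₀ (by positivity), hb]
    exact Nat.le_ceil _
  have hprob : IsProbabilityMeasure (uniformOn (sch.outcomes b m)) := by
    rw [← hRand.law_batch 0 hkout 0 hkin ⟨0, hn⟩]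
    exact Measure.isProbabilityMeasure_map
      (hRand.measurable_batch 0 hkout 0 hkin ⟨0, hn⟩).aemeasurable
  set X : ℕ → ℕ → Ω → State q n := fun t k w =>
    run M quant α (fun _ _ => γ) kin (fun t k i => J t k i w) (fun t k i => u t k i w)
      (S₀ w) (V₀ w) t k with hX
  have hGX : ∀ t k, G t k = fun w => memoryError M (X t k w) := fun t k => funext (hG t k)
  have hstep := fun t (ht : t < kout) k (hk : k < kin) (hmom : HasMoments M P (X t k)) =>
    hmom.step hm hb0 hLip hLyap hBdd hQuant hα hγ0 hγLW
      (sch := sch) (fun w => run_Vbar _ _ _ _ _ _ _ _)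
      (measurable_pi_lambda _ fun i => hRand.measurable_batch t ht k hk i)
      (measurable_pi_lambda _ fun i => hRand.measurable_noise t ht k hk i)
      (hRand.map_batch ht hk) (hRand.map_noise ht hk)
      (hRand.indepFun_run_batch hLip hQuant.measurable ht hk)
      (hRand.indepFun_run_batch_noise hLip hQuant.measurable ht hk)
      (X' := X t (k + 1)) (fun w => rfl)
  have hmom0 : HasMoments M P (X 0 0) := by
    refine ⟨?_, ?_, hW₀.sub (integrable_const _), ?_, ?_, ?_⟩
    · exact measurable_run hLip hQuant.measurable (fun _ _ => γ) kin hRand.measurable_S₀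
        hRand.measurable_V₀ 0 0 (fun t' k' h => by omega) (fun t' k' h => by omega)
    · rw [← hGX]
      exact hG₀
    · simp [hX, meanSqErr_run_zero]
    · simp [hX, sqMeanErr_run_zero]
    · simp [hX, sqIncr_run_zero]
  have hmom : ∀ t < kout, ∀ k ≤ kin, HasMoments M P (X t k) := by
    have hin : ∀ t < kout, HasMoments M P (X t 0) → ∀ k ≤ kin, HasMoments M P (X t k) := by
      intro t ht h0 k hk
      induction k with
      | zero => exact h0
      | succ k ih => exact (hstep t ht k hk (ih (by omega))).1
    intro t
    induction t with
    | zero => exact fun ht => hin 0 ht hmom0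
    | succ t ih =>
      intro ht
      exact hin (t + 1) ht ((ih (by omega) kin le_rfl).restart hLip)
  refine ⟨fun t ht k hk => hGX t k ▸ (hmom t ht k hk).integrable_memory, ?_⟩
  set g : ℕ → ℕ → ℝ := fun t k => ∫ w, memoryError M (X t k w) ∂P with hg
  set e : ℕ → ℕ → ℝ := fun t k => ∫ w, meanSqErr M (X t k w) ∂P with he
  set eb : ℕ → ℕ → ℝ := fun t k => ∫ w, sqMeanErr M (X t k w) ∂P with heb
  set p : ℕ → ℕ → ℝ := fun t k => ∫ w, sqIncr (X t k w) ∂P with hp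
  set v : ℕ → ℕ → ℝ := fun t k => ∫ w, excess M (X t k w) ∂P with hv
  set hh : ℕ → ℕ → ℝ := fun t k => ∫ w, ‖M.h (X t k w).S‖ ^ 2 ∂P with hhh
  have hp0 : ∀ t k, 0 ≤ p t k := fun t k => integral_nonneg fun w => sq_nonneg _
  have hg0 : ∀ t k, 0 ≤ g t k := fun t k => integral_nonneg fun w => memoryError_nonneg _
  have hv0 : ∀ t k, 0 ≤ v t k := fun t k => integral_nonneg fun w => excess_nonneg hBdd _
  have hpz : ∀ t, p t 0 = 0 := fun t => by simp [hp, hX, sqIncr_run_zero]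
  have hez : ∀ t, e t 0 = 0 := fun t => by simp [he, hX, meanSqErr_run_zero]
  have hebz : ∀ t, eb t 0 = 0 := fun t => by simp [heb, hX, sqMeanErr_run_zero]
  have hrec := fun t (ht : t < kout) k (hk : k < kin) => (hstep t ht k hk (hmom t ht k hk.le)).2
  rw [← hL] at hrec
  -- Sum over all iterations of the run.
  let SS : (ℕ → ℕ → ℝ) → ℝ := fun f => ∑ t ∈ Finset.range kout, ∑ k ∈ Finset.range kin, f t k
  have hSS : ∀ {f f' : ℕ → ℕ → ℝ}, (∀ t < kout, ∀ k < kin, f t k ≤ f' t k) → SS f ≤ SS f' :=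
    fun h => Finset.sum_le_sum fun t ht => Finset.sum_le_sum fun k hk =>
      h t (Finset.mem_range.1 ht) k (Finset.mem_range.1 hk)
  have hadd : ∀ f f' : ℕ → ℕ → ℝ, SS (fun t k => f t k + f' t k) = SS f + SS f' := fun f f' => by
    simp only [SS, Finset.sum_add_distrib]
  have hsub : ∀ f f' : ℕ → ℕ → ℝ, SS (fun t k => f t k - f' t k) = SS f - SS f' := fun f f' => by
    simp only [SS, Finset.sum_sub_distrib]
  have hmul : ∀ (c : ℝ) (f : ℕ → ℕ → ℝ), SS (fun t k => c * f t k) = c * SS f := fun c f => by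
    simp only [SS, Finset.mul_sum]
  have hE : SS (fun t k => e t (k + 1)) ≤ (1 + ω) ^ 2 * L ^ 2 * SS (fun t k => p t (k + 1)) := by
    have h1 : SS (fun t k => e t (k + 1)) ≤
        kin * (L ^ 2 / b) * SS (fun t k => p t (k + 1)) := by
      simp only [SS, Finset.mul_sum (s := Finset.range kout)]
      exact Finset.sum_le_sum fun t ht => sum_error_le (by positivity) (hp0 t) (hez t) (hpz t)
        fun k hk => (hrec t (Finset.mem_range.1 ht) k hk).1
    have h2 : 0 ≤ L ^ 2 * SS (fun t k => p t (k + 1)) := mul_nonneg (sq_nonneg L)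
      (Finset.sum_nonneg fun t _ => Finset.sum_nonneg fun k _ => hp0 _ _)
    have h3 := mul_le_mul_of_nonneg_right hkb h2
    calc _ ≤ _ := h1
      _ = (kin : ℝ) / b * (L ^ 2 * SS (fun t k => p t (k + 1))) := by ring
      _ ≤ _ := h3
      _ = _ := by ring
  have hEb : SS (fun t k => eb t (k + 1)) ≤
      (1 + ω) ^ 2 * L ^ 2 * SS (fun t k => p t (k + 1)) / n := by
    have h1 : SS (fun t k => eb t (k + 1)) ≤
        kin * (L ^ 2 / (n * b)) * SS (fun t k => p t (k + 1)) := by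
      simp only [SS, Finset.mul_sum (s := Finset.range kout)]
      exact Finset.sum_le_sum fun t ht => sum_error_le (by positivity) (hp0 t) (hebz t) (hpz t)
        fun k hk => (hrec t (Finset.mem_range.1 ht) k hk).2.1
    have h2 : 0 ≤ L ^ 2 * SS (fun t k => p t (k + 1)) / n := div_nonneg (mul_nonneg (sq_nonneg L)
      (Finset.sum_nonneg fun t _ => Finset.sum_nonneg fun k _ => hp0 _ _)) hn0.le
    have h3 := mul_le_mul_of_nonneg_right hkb h2
    calc _ ≤ _ := h1
      _ = (kin : ℝ) / b * (L ^ 2 * SS (fun t k => p t (k + 1)) / n) := by field_simp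
      _ ≤ _ := h3
      _ = _ := by ring
  have hP := hSS fun t ht k hk => (hrec t ht k hk).2.2.1
  have hGr := hSS fun t ht k hk => (hrec t ht k hk).2.2.2.1
  have hWr := hSS fun t ht k hk => (hrec t ht k hk).2.2.2.2
  simp only [hadd, hsub, hmul] at hP hGr hWr
  have hgtel : SS (fun t k => g t (k + 1)) - SS g = g kout 0 - g 0 0 :=
    sum_sum_sub_eq fun t => rfl
  have hvtel : SS (fun t k => v t (k + 1)) - SS v = v kout 0 - v 0 0 :=
    sum_sum_sub_eq fun t => rfl
  have hfin := sum_memory_le_of_recursions (n := n) (w0 := v 0 0) hn hLyap.LW_pos hLyap.vmin_pos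
    hLyap.vmin_le_vmax hL0 hω hα hγ (hg0 0 0)
    (Finset.sum_nonneg fun t _ => Finset.sum_nonneg fun k _ => hp0 _ _) hE hEb hP hGr
    (by rw [hgtel]; linarith [hg0 kout 0]) (by linarith [hv0 kout 0])
  have hv00 : v 0 0 = ∫ w, M.W (S₀ w) ∂P - ⨅ s, M.W s := by
    have : v 0 0 = ∫ w, (M.W (S₀ w) - ⨅ s, M.W s) ∂P := rfl
    rw [this, integral_sub hW₀ (integrable_const _)]
    simp
  have hg00 : g 0 0 = ∫ w, G 0 0 w ∂P := by simp only [hg, hGX]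
  have hsum : ∑ t ∈ Finset.range kout, ∑ k ∈ Finset.Icc 1 kin, ∫ w, G t k w ∂P
      = SS (fun t k => g t (k + 1)) := by
    simp only [sum_Icc_one_eq_sum_range, hGX, SS, hg]
  rw [hsum, ← hv00, ← hg00]
  have h1 := mul_le_mul_of_nonneg_left hfin (by positivity : 0 ≤ 1 / ((kout : ℝ) * kin))
  refine h1.trans (le_of_eq ?_)
  field_simp
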